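/- \textbf{Setting.} Let $d\ge 0$, $0<\alpha<1$ and $C_0>0$. Let $g:\mathbb{R}\setminus\{0\}\to[0,\infty)$ be smooth, supported in $[-1,1]$, with $\int (z^2\wedge 1)\,g(z)\,dz<\infty$ and $g(z)=C_0|z|^{-1-\alpha}$ for $z$ near $0$. Let $\gamma:\mathbb{R}\to\mathbb{R}^d$ be a smooth curve with $\gamma(0)=0$, all of whose derivatives of order $\ge 1$ are bounded, and suppose that for some $k$ the vectors $\gamma^{(l)}(0)$, $l\le k$, span $\mathbb{R}^d$. Let $\nu:\mathbb{R}\to[0,\infty)$ be smooth with compact support and $\nu(z)=z^4$ near $0$. Let $\mathbb{M}_d$ be the space of symmetric $d\times d$ matrices; write $\langle\cdot,v\rangle^2\in\mathbb{M}_d$ for the matrix of the quadratic form $\xi\mapsto\langle\xi,v\rangle^2$. For $h>0$ let $$\hat L^h f(x,V)=\int_{\mathbb{R}}\big(f(x+\gamma(hz),\,V+\nu(hz)\langle\cdot,\gamma'(hz)\rangle^2)-f(x,V)\big)\,g(z)\,dz$$ for $f\in C_b^\infty(\mathbb{R}^d\times\mathbb{M}_d)$, and let $\hat P^h_t$, $t\ge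 0$, be the semigroup of Markov kernels on $\mathbb{R}^d\times\mathbb{M}_d$ generated by $\frac1h\hat L^h$, that is, such that $(\hat P^h_tf-f)/t\to\frac1h\hat L^hf$ uniformly as $t\to0+$, for all $f\in C_b^\infty$. \textbf{Proposition 4.} For every real $p>0$ there is $n(p)\in\mathbb{N}$ such that for every $t>0$ there is a constant $C$ with $$\hat P^h_t[V^{-p}](x,0)\le C\,h^{-n(p)}\qquad\text{for all } 0<h\le 1 \text{ and all } x\in\mathbb{R}^d .$$ Here $V^{-p}$ denotes $\|V^{-1}\|^p$ (operator norm), with the value $+\infty$ if $V$ is singular; in particular $V$ is almost surely invertible under $\hat P^h_t((x,0),\cdot)$. -/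

import Mathlib

open MeasureTheory ProbabilityTheory Filter Topology
open scoped NNReal ENNReal ContDiff

/-- `f` belongs to `C_b^∞(E)`: it is smooth, and it is bounded together with all its derivatives. -/
def IsSmoothBounded {E : Type*} [NormedAddCommGroup E] [NormedSpace ℝ E] (f : E → ℝ) : Prop :=
  ContDiff ℝ ∞ f ∧ ∀ k : ℕ, ∃ B : ℝ, ∀ x : E, ‖iteratedFDeriv ℝ k f x‖ ≤ B

/-- `P` is a semigroup of Markov kernels on `E` whose infinitesimal generator (the uniform limit of
`(P_t f - f) / t` as `t → 0+`) is defined on `C_b^∞(E)` and is equal to `A` there. -/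
structure IsMarkovSemigroupGeneratedBy {E : Type*} [NormedAddCommGroup E] [NormedSpace ℝ E]
    [MeasurableSpace E] (A : (E → ℝ) → E → ℝ) (P : ℝ≥0 → Kernel E E) : Prop where
  isMarkovKernel : ∀ t : ℝ≥0, IsMarkovKernel (P t)
  zero : P 0 = Kernel.id
  add : ∀ s t : ℝ≥0, P (s + t) = P s ∘ₖ P t
  generator : ∀ f : E → ℝ, IsSmoothBounded f →
    TendstoUniformly (fun (t : ℝ≥0) (x : E) => ((∫ y, f y ∂(P t x)) - f x) / (t : ℝ))
      (A f) (𝓝[>] 0)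

/-- The symmetric endomorphisms of the Euclidean space `ℝ^d`, as a subspace of all endomorphisms. -/
def symmetricSubmodule (d : ℕ) :
    Submodule ℝ (EuclideanSpace ℝ (Fin d) →L[ℝ] EuclideanSpace ℝ (Fin d)) where
  carrier := {V | V.IsSymmetric}
  add_mem' := fun hV hW => LinearMap.IsSymmetric.add hV hW
  zero_mem' := LinearMap.IsSymmetric.zero
  smul_mem' := fun _ _ hV => LinearMap.IsSymmetric.smul (by simp) hV

/-- The space `𝕄_d` of symmetric `d × d` matrices, seen as symmetric endomorphisms of the Euclidean
space `ℝ^d`, with the operator norm and its Borel sets. -/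
def SymMatrix (d : ℕ) : Type := symmetricSubmodule d

noncomputable instance (d : ℕ) : NormedAddCommGroup (SymMatrix d) :=
  inferInstanceAs (NormedAddCommGroup (symmetricSubmodule d))

noncomputable instance (d : ℕ) : NormedSpace ℝ (SymMatrix d) :=
  inferInstanceAs (NormedSpace ℝ (symmetricSubmodule d))

instance (d : ℕ) : FiniteDimensional ℝ (SymMatrix d) :=
  inferInstanceAs (FiniteDimensional ℝ (symmetricSubmodule d))

instance (d : ℕ) : ProperSpace (SymMatrix d) := FiniteDimensional.proper_real _

noncomputable instance (d : ℕ) : MeasurableSpace (SymMatrix d) := borel _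

instance (d : ℕ) : BorelSpace (SymMatrix d) := ⟨rfl⟩

/-- The endomorphism `ξ ↦ V ξ` given by a symmetric matrix. -/
noncomputable def SymMatrix.toCLM {d : ℕ} :
    SymMatrix d →ₗᵢ[ℝ] (EuclideanSpace ℝ (Fin d) →L[ℝ] EuclideanSpace ℝ (Fin d)) :=
  (symmetricSubmodule d).subtypeₗᵢ

/-- The symmetric matrix of the quadratic form `ξ ↦ ⟨ξ, v⟩ ^ 2`, that is, `ξ ↦ ⟨v, ξ⟩ v`. -/
noncomputable def sqForm {d : ℕ} (v : EuclideanSpace ℝ (Fin d)) : SymMatrix d :=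
  ⟨InnerProductSpace.rankOne ℝ v v, InnerProductSpace.isSymmetric_rankOne_self v⟩

/-- The enlarged state space `ℝ^d × 𝕄_d` of pairs `(x, V)`. -/
abbrev MalliavinSpace (d : ℕ) : Type := EuclideanSpace ℝ (Fin d) × SymMatrix d

/-- The jump `(γ(w), ν(w) ⟨·, γ'(w)⟩ ^ 2)` of the enlarged process. -/
noncomputable def malliavinJump {d : ℕ} (γ : ℝ → EuclideanSpace ℝ (Fin d)) (ν : ℝ → ℝ) (w : ℝ) :
    MalliavinSpace d :=
  (γ w, ν w • sqForm (deriv γ w))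

/-- The operator `(1 / h) L̂^h`, with
`L̂^h f (x, V) = ∫ (f (x + γ(hz), V + ν(hz) ⟨·, γ'(hz)⟩ ^ 2) - f (x, V)) g(z) dz`. -/
noncomputable def malliavinGenerator {d : ℕ} (γ : ℝ → EuclideanSpace ℝ (Fin d)) (ν g : ℝ → ℝ)
    (h : ℝ) (f : MalliavinSpace d → ℝ) (y : MalliavinSpace d) : ℝ :=
  h⁻¹ * ∫ z : ℝ, (f (y + malliavinJump γ ν (h * z)) - f y) * g z

open scoped Classical in
/-- `V^{-p}`, that is, the `p`-th power of the operator norm of the inverse matrix; it is `∞` if `V`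
is singular. -/
noncomputable def invNormPow {d : ℕ} (p : ℝ) (V : SymMatrix d) : ℝ≥0∞ :=
  if IsUnit V.toCLM then ENNReal.ofReal (‖Ring.inverse V.toCLM‖ ^ p)
  else ⊤

/-- `g` is the density of the jump sizes: it is a smooth function from `ℝ ∖ {0}` to `[0, ∞)`, it is
supported in `[-1, 1]`, it integrates `z² ∧ 1`, and it is equal to `C / |z| ^ (1 + α)` near `0`, with
`0 < α < 1`. The value of `g` at `0` plays no role. -/
structure IsJumpDensity (g : ℝ → ℝ) (C α : ℝ) : Prop where
  smooth : ContDiffOn ℝ ∞ g {0}ᶜ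
  nonneg : ∀ z, z ≠ 0 → 0 ≤ g z
  support : ∀ z, 1 < |z| → g z = 0
  integrable : Integrable fun z => min (z ^ 2) 1 * g z
  const_pos : 0 < C
  index_pos : 0 < α
  index_lt_one : α < 1
  near_zero : ∀ᶠ z in 𝓝[≠] (0 : ℝ), g z = C / |z| ^ (1 + α)

/-- `γ` is a smooth curve through the origin, all of whose derivatives (of order at least one) are
bounded. -/
structure IsJumpCurve {d : ℕ} (γ : ℝ → EuclideanSpace ℝ (Fin d)) : Prop where
  smooth : ContDiff ℝ ∞ γ
  zero : γ 0 = 0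
  bounded : ∀ l : ℕ, 1 ≤ l → ∃ B : ℝ, ∀ z, ‖iteratedDeriv l γ z‖ ≤ B

/-- The derivatives of `γ` at `0` up to some finite order span `ℝ^d`. -/
def SpanCondition {d : ℕ} (γ : ℝ → EuclideanSpace ℝ (Fin d)) : Prop :=
  ∃ k : ℕ, Submodule.span ℝ {v | ∃ l ≤ k, v = iteratedDeriv l γ 0} = ⊤

/-- `ν` is a nonnegative smooth function with compact support, equal to `z ^ 4` near `0`. -/
structure IsJumpWeight (ν : ℝ → ℝ) : Prop where
  smooth : ContDiff ℝ ∞ ν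
  compact : HasCompactSupport ν
  nonneg : ∀ z, 0 ≤ ν z
  near_zero : ∀ᶠ z in 𝓝 (0 : ℝ), ν z = z ^ 4

/-! ### Existence of the semigroup

The rest of this file is not needed to read the statement: it proves that `malliavinGenerator` is the
generator of a Markov semigroup, which is built as the law of a sum of independent compound Poisson
variables. -/

namespace LevySemigroup

section

variable {E : Type*} [NormedAddCommGroup E] [NormedSpace ℝ E] [MeasurableSpace E] [BorelSpace E]
  [SecondCountableTopology E]

/-- Convolution powers of a measure. -/
noncomputable def convPow (ρ : Measure E) : ℕ → Measure E
  | 0 => Measure.dirac 0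
  | k + 1 => convPow ρ k ∗ ρ

/-- The compound Poisson law at time `t` with finite jump measure `ρ`. -/
noncomputable def cp (ρ : Measure E) (t : ℝ≥0) : Measure E :=
  Measure.sum fun k : ℕ =>
    ENNReal.ofReal (Real.exp (-(t * ρ.real Set.univ)) * (t : ℝ) ^ k / k.factorial) • convPow ρ k

instance convPow_finite (ρ : Measure E) [IsFiniteMeasure ρ] (k : ℕ) :
    IsFiniteMeasure (convPow ρ k) := by
  induction k with
  | zero => unfold convPow; infer_instance
  | succ k ih => unfold convPow; infer_instance

lemma conv_univ (μ ν : Measure E) [IsFiniteMeasure μ] [IsFiniteMeasure ν] :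
    (μ ∗ ν) Set.univ = μ Set.univ * ν Set.univ := by
  rw [Measure.conv, Measure.map_apply (by fun_prop) MeasurableSet.univ, Set.preimage_univ,
    ← Set.univ_prod_univ, Measure.prod_prod]

lemma convPow_univ (ρ : Measure E) [IsFiniteMeasure ρ] (k : ℕ) :
    (convPow ρ k) Set.univ = (ρ Set.univ) ^ k := by
  induction k with
  | zero => simp [convPow]
  | succ k ih => rw [convPow, conv_univ, ih, pow_succ]

lemma hasSum_weights (lam t : ℝ) :
    HasSum (fun k : ℕ => Real.exp (-(t * lam)) * t ^ k / k.factorial * lam ^ k) 1 := by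
  have h := (NormedSpace.expSeries_div_hasSum_exp (𝔸 := ℝ) (t * lam)).mul_left
    (Real.exp (-(t * lam)))
  rw [← Real.exp_eq_exp_ℝ, ← Real.exp_add] at h
  simp only [neg_add_cancel, Real.exp_zero] at h
  refine h.congr_fun ?_ |> fun h => h
  intro k
  rw [mul_pow]; ring

instance cp_prob (ρ : Measure E) [IsFiniteMeasure ρ] (t : ℝ≥0) : IsProbabilityMeasure (cp ρ t) := by
  constructor
  rw [cp, Measure.sum_apply _ MeasurableSet.univ]
  have h := hasSum_weights (ρ.real Set.univ) t
  have : ∀ k : ℕ, (ENNReal.ofReal (Real.exp (-(t * ρ.real Set.univ)) * (t : ℝ) ^ k / k.factorial) •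
      convPow ρ k) Set.univ = ENNReal.ofReal (Real.exp (-(t * ρ.real Set.univ)) * (t : ℝ) ^ k /
        k.factorial * (ρ.real Set.univ) ^ k) := by
    intro k
    rw [ENNReal.ofReal_mul (by positivity), Measure.smul_apply, convPow_univ, smul_eq_mul,
      ENNReal.ofReal_pow (by positivity), Measure.real, ENNReal.ofReal_toReal (measure_ne_top _ _)]
  simp_rw [this]
  rw [← ENNReal.ofReal_tsum_of_nonneg (fun k => by positivity) h.summable, h.tsum_eq]
  simp

/-- Integrals against a compound Poisson law. -/
lemma hasSum_integral_cp {F : Type*} [NormedAddCommGroup F] [NormedSpace ℝ F]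
    (ρ : Measure E) [IsFiniteMeasure ρ] (t : ℝ≥0) (f : E → F) (hf : Integrable f (cp ρ t)) :
    HasSum (fun k : ℕ => (Real.exp (-(t * ρ.real Set.univ)) * (t : ℝ) ^ k / k.factorial) •
      ∫ y, f y ∂(convPow ρ k)) (∫ y, f y ∂(cp ρ t)) := by
  have h := hasSum_integral_measure hf
  refine h.congr_fun ?_ |> fun h => h
  intro k
  rw [integral_smul_measure, ENNReal.toReal_ofReal (by positivity)]

lemma charFunDual_convPow (ρ : Measure E) [IsFiniteMeasure ρ] (k : ℕ) (L : StrongDual ℝ E) :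
    charFunDual (convPow ρ k) L = (charFunDual ρ L) ^ k := by
  induction k with
  | zero => simp [convPow]
  | succ k ih => rw [convPow, charFunDual_conv, ih, pow_succ]

lemma charFunDual_cp (ρ : Measure E) [IsFiniteMeasure ρ] (t : ℝ≥0) (L : StrongDual ℝ E) :
    charFunDual (cp ρ t) L = Complex.exp (t * (charFunDual ρ L - ρ.real Set.univ)) := by
  have hint : Integrable (fun v : E => Complex.exp (L v * Complex.I)) (cp ρ t) :=
    (integrable_const (1 : ℝ)).mono (by fun_prop) (by simp)
  have h := hasSum_integral_cp ρ t _ hint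
  simp_rw [← charFunDual_apply, charFunDual_convPow] at h
  have h2 := (NormedSpace.expSeries_div_hasSum_exp (𝔸 := ℂ) (t * charFunDual ρ L)).mul_left
    (Complex.exp (-(t * ρ.real Set.univ)))
  rw [← Complex.exp_eq_exp_ℂ, ← Complex.exp_add] at h2
  rw [show (t : ℂ) * (charFunDual ρ L - ρ.real Set.univ)
    = -(t * ρ.real Set.univ) + t * charFunDual ρ L by ring]
  refine h.unique (h2.congr_fun ?_)
  intro k
  rw [Complex.real_smul, mul_pow]
  push_cast
  ring

lemma lintegral_convPow (ρ : Measure E) [IsFiniteMeasure ρ] (k : ℕ) :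
    ∫⁻ y, ‖y‖ₑ ∂(convPow ρ (k + 1)) ≤ (k + 1) * (ρ Set.univ) ^ k * ∫⁻ y, ‖y‖ₑ ∂ρ := by
  induction k with
  | zero => simp [convPow]
  | succ k ih =>
    rw [convPow, Measure.lintegral_conv (by fun_prop)]
    calc ∫⁻ x, ∫⁻ y, ‖x + y‖ₑ ∂ρ ∂(convPow ρ (k + 1))
        ≤ ∫⁻ x, ∫⁻ y, (‖x‖ₑ + ‖y‖ₑ) ∂ρ ∂(convPow ρ (k + 1)) := by
          gcongr; exact enorm_add_le _ _
      _ = (∫⁻ x, ‖x‖ₑ ∂(convPow ρ (k + 1))) * ρ Set.univ +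
          (∫⁻ y, ‖y‖ₑ ∂ρ) * (ρ Set.univ) ^ (k + 1) := by
          simp_rw [lintegral_add_left measurable_const, lintegral_const]
          rw [lintegral_add_right _ measurable_const, lintegral_const,
            lintegral_mul_const _ (by fun_prop), convPow_univ]
      _ ≤ ((k + 1) * (ρ Set.univ) ^ k * ∫⁻ y, ‖y‖ₑ ∂ρ) * ρ Set.univ +
          (∫⁻ y, ‖y‖ₑ ∂ρ) * (ρ Set.univ) ^ (k + 1) := by gcongr
      _ = _ := by push_cast; ring

lemma lintegral_cp (ρ : Measure E) [IsFiniteMeasure ρ] (t : ℝ≥0) :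
    ∫⁻ y, ‖y‖ₑ ∂(cp ρ t) ≤ t * ∫⁻ y, ‖y‖ₑ ∂ρ := by
  rw [cp, lintegral_sum_measure, tsum_eq_zero_add' ENNReal.summable]
  simp_rw [lintegral_smul_measure]
  have h0 : ∫⁻ y : E, ‖y‖ₑ ∂(convPow ρ 0) = 0 := by simp [convPow]
  rw [h0, smul_zero, zero_add]
  have h := hasSum_weights (ρ.real Set.univ) t
  have key : ∀ k : ℕ, ENNReal.ofReal (Real.exp (-(t * ρ.real Set.univ)) * (t : ℝ) ^ (k + 1) /
      (k + 1).factorial) • ∫⁻ y, ‖y‖ₑ ∂(convPow ρ (k + 1)) ≤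
      ENNReal.ofReal (Real.exp (-(t * ρ.real Set.univ)) * (t : ℝ) ^ k / k.factorial *
        ρ.real Set.univ ^ k) * (t * ∫⁻ y, ‖y‖ₑ ∂ρ) := by
    intro k
    rw [smul_eq_mul]
    refine (mul_le_mul_right (lintegral_convPow ρ k) _).trans (le_of_eq ?_)
    have e1 : ((k : ℝ≥0∞) + 1) = ENNReal.ofReal ((k : ℝ) + 1) := by
      rw [ENNReal.ofReal_add (by positivity) (by positivity)]; simp
    have e2 : (ρ Set.univ) ^ k = ENNReal.ofReal (ρ.real Set.univ ^ k) := by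
      rw [ENNReal.ofReal_pow (by positivity), Measure.real,
        ENNReal.ofReal_toReal (measure_ne_top _ _)]
    have e3 : (t : ℝ≥0∞) = ENNReal.ofReal (t : ℝ) := by simp
    rw [e1, e2, e3]
    simp only [← mul_assoc]
    rw [← ENNReal.ofReal_mul (by positivity), ← ENNReal.ofReal_mul (by positivity),
      ← ENNReal.ofReal_mul (by positivity)]
    congr 2
    rw [Nat.factorial_succ]
    push_cast
    field_simp
    ring
  refine (ENNReal.tsum_le_tsum key).trans ?_
  rw [ENNReal.tsum_mul_right, ← ENNReal.ofReal_tsum_of_nonneg (fun k => by positivity) h.summable,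
    h.tsum_eq]
  simp

/-- Short-time expansion of a compound Poisson law. -/
lemma cp_expansion (ρ : Measure E) [IsFiniteMeasure ρ] (t : ℝ≥0) (f : E → ℝ) (hf : Continuous f)
    (M : ℝ) (hM : ∀ x, |f x| ≤ M) (ht : t * ρ.real Set.univ ≤ 1) (x : E) :
    |(∫ y, f (x + y) ∂(cp ρ t)) - f x - t * ∫ y, (f (x + y) - f x) ∂ρ| ≤
      3 * M * (t * ρ.real Set.univ) ^ 2 := by
  have hM0 : 0 ≤ M := (abs_nonneg _).trans (hM 0)
  have hint : ∀ (μ : Measure E) [IsFiniteMeasure μ], Integrable (fun y => f (x + y)) μ :=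
    fun μ _ => (integrable_const M).mono (by fun_prop)
      (by simpa [abs_of_nonneg hM0] using ae_of_all _ fun y => hM (x + y))
  set lam := ρ.real Set.univ with hlam
  set a : ℕ → ℝ := fun k => ∫ y, f (x + y) ∂(convPow ρ k) with ha
  have hlam0 : 0 ≤ lam := by positivity
  set u : ℝ := t * lam with hu
  have hu0 : 0 ≤ u := by positivity
  have hs := (hasSum_integral_cp ρ t _ (hint (cp ρ t))).mul_left (Real.exp u)
  have hs' : HasSum (fun k : ℕ => (t : ℝ) ^ k / k.factorial * a k)
      (Real.exp u * ∫ y, f (x + y) ∂(cp ρ t)) := by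
    refine hs.congr_fun ?_ |> fun h => h
    intro k
    simp only [smul_eq_mul, ← hlam, ← hu]
    rw [Real.exp_neg]
    field_simp
    rfl
  have hak : ∀ k, |a k| ≤ M * lam ^ k := by
    intro k
    have h1 : ∀ y, ‖f (x + y)‖ ≤ M := fun y => hM (x + y)
    refine (norm_integral_le_of_norm_le_const (μ := convPow ρ k) (ae_of_all _ h1)).trans ?_
    rw [Measure.real, convPow_univ, ENNReal.toReal_pow]
    rfl
  have ha0 : a 0 = f x := by simp [ha, convPow]
  have ha1 : a 1 = (∫ y, (f (x + y) - f x) ∂ρ) + lam * f x := by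
    rw [integral_sub (hint ρ) (integrable_const _)]
    simp [ha, convPow, hlam]
  have hs2 := (hasSum_nat_add_iff' 2).mpr hs'
  have he2 := (hasSum_nat_add_iff' 2).mpr
    ((NormedSpace.expSeries_div_hasSum_exp (𝔸 := ℝ) u).mul_left M)
  rw [← Real.exp_eq_exp_ℝ] at he2
  set R := Real.exp u * ∫ y, f (x + y) ∂(cp ρ t) with hR
  have e2 : R - ∑ i ∈ Finset.range 2, (t : ℝ) ^ i / i.factorial * a i = R - (a 0 + t * a 1) := by
    simp [Finset.sum_range_succ]
  have e3 : M * Real.exp u - ∑ i ∈ Finset.range 2, M * (u ^ i / i.factorial) =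
      M * Real.exp u - (M + M * u) := by
    simp [Finset.sum_range_succ]
  rw [e2] at hs2
  rw [e3] at he2
  have hb : |R - (a 0 + t * a 1)| ≤ M * Real.exp u - (M + M * u) := by
    rw [← Real.norm_eq_abs, ← hs2.tsum_eq]
    refine tsum_of_norm_bounded he2 ?_
    intro k
    rw [Real.norm_eq_abs, abs_mul, abs_of_nonneg (by positivity)]
    refine (mul_le_mul_of_nonneg_left (hak (k + 2)) (by positivity)).trans (le_of_eq ?_)
    rw [hu, mul_pow]
    simp only [Nat.factorial]
    ring
  have hexp1 : |Real.exp u - 1 - u| ≤ u ^ 2 :=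
    Real.abs_exp_sub_one_sub_id_le (by rw [abs_of_nonneg hu0]; exact ht)
  have hexp2 : |Real.exp (-u) - 1 - (-u)| ≤ u ^ 2 := by
    have := Real.abs_exp_sub_one_sub_id_le (x := -u) (by rw [abs_neg, abs_of_nonneg hu0]; exact ht)
    simpa using this
  have hI : ∫ y, f (x + y) ∂(cp ρ t) = Real.exp (-u) * R := by
    rw [hR, ← mul_assoc, ← Real.exp_add]; simp
  have hEle : Real.exp (-u) ≤ 1 := Real.exp_le_one_iff.mpr (by linarith)
  have hE0 := Real.exp_pos (-u)
  have hta1 : |t * a 1| ≤ M * u := by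
    rw [abs_mul, abs_of_nonneg (by positivity : (0 : ℝ) ≤ t)]
    calc (t : ℝ) * |a 1| ≤ t * (M * lam ^ 1) := by gcongr; exact hak 1
      _ = M * u := by rw [hu]; ring
  have hone : |Real.exp (-u) - 1| ≤ u := by
    rw [abs_of_nonpos (by linarith)]
    have := Real.add_one_le_exp (-u)
    linarith
  have hdecomp : (∫ y, f (x + y) ∂(cp ρ t)) - f x - t * ∫ y, (f (x + y) - f x) ∂ρ =
      f x * (Real.exp (-u) - 1 - (-u)) + (t * a 1) * (Real.exp (-u) - 1) +
        Real.exp (-u) * (R - (a 0 + t * a 1)) := by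
    rw [hI, show (∫ y, (f (x + y) - f x) ∂ρ) = a 1 - lam * f x by rw [ha1]; ring, ha0, hu]
    ring
  rw [hdecomp]
  have t1 : |f x * (Real.exp (-u) - 1 - (-u))| ≤ M * u ^ 2 := by
    rw [abs_mul]; exact mul_le_mul (hM x) hexp2 (abs_nonneg _) hM0
  have t2 : |(t * a 1) * (Real.exp (-u) - 1)| ≤ M * u * u := by
    rw [abs_mul]; exact mul_le_mul hta1 hone (abs_nonneg _) (by positivity)
  have t3 : |Real.exp (-u) * (R - (a 0 + t * a 1))| ≤ M * u ^ 2 := by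
    rw [abs_mul, abs_of_pos hE0]
    have h1 : M * Real.exp u - (M + M * u) ≤ M * u ^ 2 := by
      have := mul_le_mul_of_nonneg_left ((le_abs_self _).trans hexp1) hM0
      linarith
    calc Real.exp (-u) * |R - (a 0 + t * a 1)| ≤ 1 * (M * u ^ 2) := by
          gcongr; exact hb.trans h1
      _ = _ := one_mul _
  calc _ ≤ _ := abs_add_three _ _ _
    _ ≤ M * u ^ 2 + M * u * u + M * u ^ 2 := by gcongr
    _ = _ := by ring

variable [CompleteSpace E]

lemma cp_zero (ρ : Measure E) [IsFiniteMeasure ρ] : cp ρ 0 = Measure.dirac 0 := by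
  apply Measure.ext_of_charFunDual
  ext L
  rw [charFunDual_cp]
  simp

lemma cp_conv (ρ ρ' : Measure E) [IsFiniteMeasure ρ] [IsFiniteMeasure ρ'] (t : ℝ≥0) :
    cp (ρ + ρ') t = cp ρ t ∗ cp ρ' t := by
  apply Measure.ext_of_charFunDual
  ext L
  rw [charFunDual_conv, charFunDual_cp, charFunDual_cp, charFunDual_cp, ← Complex.exp_add]
  have h : charFunDual (ρ + ρ') L = charFunDual ρ L + charFunDual ρ' L := by
    simp_rw [charFunDual_apply]
    rw [integral_add_measure] <;>
    exact (integrable_const (1 : ℝ)).mono (by fun_prop) (by simp)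
  rw [h, measureReal_add_apply]
  congr 1
  push_cast
  ring

end

end LevySemigroup

namespace LevySemigroup

section

variable {E : Type*} [NormedAddCommGroup E] [NormedSpace ℝ E] [MeasurableSpace E] [BorelSpace E]
  [SecondCountableTopology E] [CompleteSpace E]

/-- Partial sums of a decomposition of `ρ` into finite measures. -/
noncomputable def head (ρ : Measure E) [SFinite ρ] (N : ℕ) : Measure E :=
  ∑ n ∈ Finset.range N, sfiniteSeq ρ n

instance (ρ : Measure E) [SFinite ρ] (N : ℕ) : IsFiniteMeasure (head ρ N) := by
  unfold head; infer_instance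

/-- The remainders of this decomposition. -/
noncomputable def tail (ρ : Measure E) [SFinite ρ] (N : ℕ) : Measure E :=
  Measure.sum fun n => sfiniteSeq ρ (n + N)

lemma head_add_tail (ρ : Measure E) [SFinite ρ] (N : ℕ) : head ρ N + tail ρ N = ρ := by
  conv_rhs => rw [← sum_sfiniteSeq ρ]
  ext s hs
  rw [Measure.add_apply, head, tail, Measure.sum_apply _ hs, Measure.sum_apply _ hs,
    Measure.finsetSum_apply]
  exact Summable.sum_add_tsum_nat_add' ENNReal.summable

lemma tendsto_tail (ρ : Measure E) [SFinite ρ] (hρ : ∫⁻ y, ‖y‖ₑ ∂ρ ≠ ⊤) :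
    Tendsto (fun N => ∫⁻ y, ‖y‖ₑ ∂(tail ρ N)) atTop (𝓝 0) := by
  simp_rw [tail, lintegral_sum_measure]
  apply ENNReal.tendsto_sum_nat_add fun i => ∫⁻ y, ‖y‖ₑ ∂(sfiniteSeq ρ i)
  rwa [← lintegral_sum_measure, sum_sfiniteSeq]

/-- The joint law of independent compound Poisson variables. -/
noncomputable def joint (ρ : Measure E) [SFinite ρ] (t : ℝ≥0) : Measure (ℕ → E) :=
  Measure.infinitePi fun n => cp (sfiniteSeq ρ n) t

instance (ρ : Measure E) [SFinite ρ] (t : ℝ≥0) : IsProbabilityMeasure (joint ρ t) := by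
  unfold joint; infer_instance

/-- The law at time `t` of the pure jump process with Lévy measure `ρ`. -/
noncomputable def law (ρ : Measure E) [SFinite ρ] (t : ℝ≥0) : Measure E :=
  (joint ρ t).map fun w => ∑' n, w n

lemma map_partial (ρ : Measure E) [SFinite ρ] (t : ℝ≥0) (N : ℕ) :
    (joint ρ t).map (fun w => ∑ n ∈ Finset.range N, w n) = cp (head ρ N) t := by
  induction N with
  | zero =>
    simp only [Finset.range_zero, Finset.sum_empty, Measure.map_const, measure_univ, one_smul]
    apply Measure.ext_of_charFunDual
    ext L
    rw [charFunDual_cp]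
    simp [head, charFunDual_apply]
  | succ N ih =>
    have hind : iIndepFun (fun (n : ℕ) (w : ℕ → E) => w n) (joint ρ t) :=
      iIndepFun_infinitePi (X := fun (_ : ℕ) (x : E) => x) (fun _ => measurable_id)
    have h2 := hind.indepFun_finsetSum_of_notMem (fun n => measurable_pi_apply n)
      (s := Finset.range N) (i := N) (by simp)
    have h3 := h2.map_add_eq_map_conv_map₀ (by fun_prop)
      (measurable_pi_apply N).aemeasurable
    have e : (fun w : ℕ → E => ∑ n ∈ Finset.range (N + 1), w n) =
        (∑ j ∈ Finset.range N, fun (w : ℕ → E) => w j) + fun w => w N := by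
      ext w; simp [Finset.sum_range_succ]
    have e' : (∑ j ∈ Finset.range N, fun (w : ℕ → E) => w j) =
        fun w : ℕ → E => ∑ n ∈ Finset.range N, w n := by
      ext w; simp
    rw [e, h3, e', ih, show head ρ (N + 1) = head ρ N + sfiniteSeq ρ N from
      Finset.sum_range_succ _ _, cp_conv]
    congr 1
    exact Measure.infinitePi_map_eval _ N

lemma lintegral_coord (ρ : Measure E) [SFinite ρ] (t : ℝ≥0) (n : ℕ) :
    ∫⁻ w, ‖w n‖ₑ ∂(joint ρ t) ≤ t * ∫⁻ y, ‖y‖ₑ ∂(sfiniteSeq ρ n) := by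
  have h : (joint ρ t).map (fun w => w n) = cp (sfiniteSeq ρ n) t :=
    Measure.infinitePi_map_eval _ n
  rw [← lintegral_map (f := fun y : E => ‖y‖ₑ) (g := fun w : ℕ → E => w n)
    (by fun_prop) (by fun_prop), h]
  exact lintegral_cp _ t

lemma lintegral_tsum_coord (ρ : Measure E) [SFinite ρ] (t : ℝ≥0) (N : ℕ) :
    ∫⁻ w, ∑' n, ‖w (n + N)‖ₑ ∂(joint ρ t) ≤ t * ∫⁻ y, ‖y‖ₑ ∂(tail ρ N) := by
  rw [lintegral_tsum (fun n => (measurable_pi_apply (n + N)).enorm.aemeasurable), tail, lintegral_sum_measure, ← ENNReal.tsum_mul_left]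
  exact ENNReal.tsum_le_tsum fun n => lintegral_coord ρ t (n + N)

lemma tail_zero (ρ : Measure E) [SFinite ρ] : tail ρ 0 = ρ := by
  have := head_add_tail ρ 0
  simpa [head] using this

lemma ae_summable (ρ : Measure E) [SFinite ρ] (hρ : ∫⁻ y, ‖y‖ₑ ∂ρ ≠ ⊤) (t : ℝ≥0) :
    ∀ᵐ w ∂(joint ρ t), Summable fun n => ‖w n‖ := by
  have h := lintegral_tsum_coord ρ t 0
  rw [tail_zero] at h
  have h2 : ∫⁻ w, ∑' n, ‖w (n + 0)‖ₑ ∂(joint ρ t) ≠ ⊤ :=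
    (h.trans_lt (ENNReal.mul_lt_top ENNReal.coe_lt_top hρ.lt_top)).ne
  filter_upwards [ae_lt_top (by fun_prop) h2] with w hw
  exact tsum_enorm_ne_top_iff_summable_norm.1 hw.ne

lemma aemeasurable_tsum (ρ : Measure E) [SFinite ρ] (hρ : ∫⁻ y, ‖y‖ₑ ∂ρ ≠ ⊤) (t : ℝ≥0) :
    AEMeasurable (fun w : ℕ → E => ∑' n, w n) (joint ρ t) := by
  refine aemeasurable_of_tendsto_metrizable_ae (u := atTop)
    (f := fun (N : ℕ) (w : ℕ → E) => ∑ n ∈ Finset.range N, w n) (fun N => by fun_prop) ?_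
  filter_upwards [ae_summable ρ hρ t] with w hw
  exact hw.of_norm.hasSum.tendsto_sum_nat

lemma law_prob (ρ : Measure E) [SFinite ρ] (hρ : ∫⁻ y, ‖y‖ₑ ∂ρ ≠ ⊤) (t : ℝ≥0) :
    IsProbabilityMeasure (law ρ t) :=
  Measure.isProbabilityMeasure_map (aemeasurable_tsum ρ hρ t)

lemma tendsto_charFunDual (ρ : Measure E) [SFinite ρ] (hρ : ∫⁻ y, ‖y‖ₑ ∂ρ ≠ ⊤) (t : ℝ≥0)
    (L : StrongDual ℝ E) :
    Tendsto (fun N => charFunDual (cp (head ρ N) t) L) atTop (𝓝 (charFunDual (law ρ t) L)) := by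
  have hc : Continuous fun v : E => Complex.exp (L v * Complex.I) := by fun_prop
  simp_rw [← map_partial, charFunDual_apply]
  rw [law, integral_map (aemeasurable_tsum ρ hρ t) hc.aestronglyMeasurable]
  have e : ∀ N : ℕ, ∫ v, Complex.exp (L v * Complex.I)
      ∂((joint ρ t).map fun w => ∑ n ∈ Finset.range N, w n) =
      ∫ w, Complex.exp (L (∑ n ∈ Finset.range N, w n) * Complex.I) ∂(joint ρ t) := fun N =>
    integral_map (by fun_prop) hc.aestronglyMeasurable
  simp_rw [e]
  refine tendsto_integral_of_dominated_convergence (fun _ => (1 : ℝ))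
    (fun N => ?_) (integrable_const _) (fun N => ?_) ?_
  · exact (hc.measurable.comp (by fun_prop :
      Measurable fun w : ℕ → E => ∑ n ∈ Finset.range N, w n)).aestronglyMeasurable
  · refine ae_of_all _ fun w => ?_
    rw [Complex.norm_exp_ofReal_mul_I]
  · filter_upwards [ae_summable ρ hρ t] with w hw
    exact (hc.tendsto _).comp hw.of_norm.hasSum.tendsto_sum_nat

lemma law_zero (ρ : Measure E) [SFinite ρ] (hρ : ∫⁻ y, ‖y‖ₑ ∂ρ ≠ ⊤) :
    law ρ 0 = Measure.dirac 0 := by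
  have := law_prob ρ hρ 0
  apply Measure.ext_of_charFunDual
  ext L
  refine tendsto_nhds_unique (tendsto_charFunDual ρ hρ 0 L) ?_
  simp_rw [cp_zero]
  exact tendsto_const_nhds

lemma law_add (ρ : Measure E) [SFinite ρ] (hρ : ∫⁻ y, ‖y‖ₑ ∂ρ ≠ ⊤) (s t : ℝ≥0) :
    law ρ (s + t) = law ρ t ∗ law ρ s := by
  have := law_prob ρ hρ s
  have := law_prob ρ hρ t
  have := law_prob ρ hρ (s + t)
  apply Measure.ext_of_charFunDual
  ext L
  rw [charFunDual_conv]
  refine tendsto_nhds_unique (tendsto_charFunDual ρ hρ (s + t) L) ?_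
  refine ((tendsto_charFunDual ρ hρ t L).mul (tendsto_charFunDual ρ hρ s L)).congr fun N => ?_
  rw [charFunDual_cp, charFunDual_cp, charFunDual_cp, ← Complex.exp_add]
  congr 1
  push_cast
  ring

/-- The translation invariant Markov semigroup with Lévy measure `ρ`. -/
noncomputable def kernel (ρ : Measure E) [SFinite ρ] (t : ℝ≥0) : Kernel E E :=
  (Kernel.id ×ₖ Kernel.const E (law ρ t)).map fun p : E × E => p.1 + p.2

lemma kernel_apply (ρ : Measure E) [SFinite ρ] (hρ : ∫⁻ y, ‖y‖ₑ ∂ρ ≠ ⊤) (t : ℝ≥0) (x : E) :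
    kernel ρ t x = Measure.dirac x ∗ law ρ t := by
  have := law_prob ρ hρ t
  rw [kernel, Kernel.map_apply _ (by fun_prop), Kernel.prod_apply, Kernel.id_apply,
    Kernel.const_apply]
  rfl

lemma lintegral_norm_sub (ρ : Measure E) [SFinite ρ] (hρ : ∫⁻ y, ‖y‖ₑ ∂ρ ≠ ⊤) (t : ℝ≥0)
    (N : ℕ) : ∫⁻ w, ‖(∑' n, w n) - ∑ n ∈ Finset.range N, w n‖ₑ ∂(joint ρ t) ≤
      t * ∫⁻ y, ‖y‖ₑ ∂(tail ρ N) := by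
  refine le_trans (lintegral_mono_ae ?_) (lintegral_tsum_coord ρ t N)
  filter_upwards [ae_summable ρ hρ t] with w hw
  rw [← hw.of_norm.sum_add_tsum_nat_add N, add_sub_cancel_left]
  exact enorm_tsum_le_tsum_enorm

lemma norm_integral_le_lip {Ω : Type*} [MeasurableSpace Ω] (μ : Measure Ω) (F : Ω → ℝ)
    (K : ℝ) (Y : Ω → E) (I : ℝ≥0∞) (hI : I ≠ ⊤) (hF : ∀ w, |F w| ≤ K * ‖Y w‖) (hK : 0 ≤ K)
    (hY : ∫⁻ w, ‖Y w‖ₑ ∂μ ≤ I) : |∫ w, F w ∂μ| ≤ K * I.toReal := by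
  have h1 := norm_integral_le_lintegral_norm (μ := μ) F
  refine h1.trans ?_
  rw [← ENNReal.toReal_ofReal hK, ← ENNReal.toReal_mul]
  refine ENNReal.toReal_mono (ENNReal.mul_ne_top ENNReal.ofReal_ne_top hI) ?_
  calc ∫⁻ w, ENNReal.ofReal ‖F w‖ ∂μ ≤ ∫⁻ w, ENNReal.ofReal K * ‖Y w‖ₑ ∂μ := by
        refine lintegral_mono fun w => ?_
        rw [← ofReal_norm, ← ENNReal.ofReal_mul hK]
        exact ENNReal.ofReal_le_ofReal (hF w)
    _ = ENNReal.ofReal K * ∫⁻ w, ‖Y w‖ₑ ∂μ := lintegral_const_mul' _ _ ENNReal.ofReal_ne_top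
    _ ≤ _ := by gcongr

/-- Short-time expansion of the law. -/
lemma law_expansion (ρ : Measure E) [SFinite ρ] (hρ : ∫⁻ y, ‖y‖ₑ ∂ρ ≠ ⊤) (t : ℝ≥0) (N : ℕ)
    (f : E → ℝ) (hf : Continuous f) (M : ℝ) (hM : ∀ x, |f x| ≤ M) (K : ℝ≥0)
    (hK : LipschitzWith K f) (ht : t * (head ρ N).real Set.univ ≤ 1) (x : E) :
    |(∫ y, f (x + y) ∂(law ρ t)) - f x - t * ∫ y, (f (x + y) - f x) ∂ρ| ≤
      3 * M * (t * (head ρ N).real Set.univ) ^ 2 +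
        2 * (K * (t * (∫⁻ y, ‖y‖ₑ ∂(tail ρ N)).toReal)) := by
  have hM0 : 0 ≤ M := (abs_nonneg _).trans (hM 0)
  have hlip : ∀ a b : E, |f a - f b| ≤ K * ‖a - b‖ := fun a b => by
    have := hK.dist_le_mul a b
    rwa [Real.dist_eq, dist_eq_norm] at this
  have hlip' : ∀ y : E, |f (x + y) - f x| ≤ K * ‖y‖ := fun y => by
    simpa using hlip (x + y) x
  have htail : ∫⁻ y, ‖y‖ₑ ∂(tail ρ N) ≠ ⊤ := by
    refine ne_top_of_le_ne_top hρ (lintegral_mono' ?_ le_rfl)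
    conv_rhs => rw [← head_add_tail ρ N]
    exact Measure.le_add_left le_rfl
  have hcf : Continuous fun y => f (x + y) := by fun_prop
  have hb : ∀ y, ‖f (x + y)‖ ≤ M := fun y => hM (x + y)
  -- comparison of the laws
  have c1 : |(∫ y, f (x + y) ∂(law ρ t)) - ∫ y, f (x + y) ∂(cp (head ρ N) t)| ≤
      K * (t * (∫⁻ y, ‖y‖ₑ ∂(tail ρ N)).toReal) := by
    rw [law, ← map_partial, integral_map (aemeasurable_tsum ρ hρ t) hcf.aestronglyMeasurable,
      integral_map (by fun_prop) hcf.aestronglyMeasurable, ← integral_sub]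
    · have := norm_integral_le_lip (joint ρ t)
        (fun w => f (x + ∑' n, w n) - f (x + ∑ n ∈ Finset.range N, w n)) K
        (fun w => (∑' n, w n) - ∑ n ∈ Finset.range N, w n) (t * ∫⁻ y, ‖y‖ₑ ∂(tail ρ N))
        (ENNReal.mul_ne_top ENNReal.coe_ne_top htail) (fun w => by
          simpa using hlip (x + ∑' n, w n) (x + ∑ n ∈ Finset.range N, w n)) K.coe_nonneg
        (lintegral_norm_sub ρ hρ t N)
      rwa [ENNReal.toReal_mul, ENNReal.coe_toReal] at this
    · exact (integrable_const M).mono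
        (hcf.measurable.comp_aemeasurable (aemeasurable_tsum ρ hρ t)).aestronglyMeasurable
        (ae_of_all _ fun w => (hb _).trans (le_abs_self M))
    · exact (integrable_const M).mono
        (hcf.measurable.comp (by fun_prop :
          Measurable fun w : ℕ → E => ∑ n ∈ Finset.range N, w n)).aestronglyMeasurable
        (ae_of_all _ fun w => (hb _).trans (le_abs_self M))
  -- comparison of the generators
  have hint : Integrable (fun y => f (x + y) - f x) ρ := by
    refine ⟨(by fun_prop : Continuous fun y => f (x + y) - f x).aestronglyMeasurable, ?_⟩
    refine lt_of_le_of_lt (b := ∫⁻ y, K * ‖y‖ₑ ∂ρ) (lintegral_mono fun y => ?_) ?_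
    · rw [← ofReal_norm, ← ofReal_norm, ← ENNReal.ofReal_coe_nnreal,
        ← ENNReal.ofReal_mul K.coe_nonneg]
      exact ENNReal.ofReal_le_ofReal (hlip' y)
    · rw [lintegral_const_mul' _ _ ENNReal.coe_ne_top]
      exact ENNReal.mul_lt_top ENNReal.coe_lt_top hρ.lt_top
  have c2 : |(∫ y, (f (x + y) - f x) ∂ρ) - ∫ y, (f (x + y) - f x) ∂(head ρ N)| ≤
      K * (∫⁻ y, ‖y‖ₑ ∂(tail ρ N)).toReal := by
    have e : (∫ y, (f (x + y) - f x) ∂ρ) = (∫ y, (f (x + y) - f x) ∂(head ρ N)) +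
        ∫ y, (f (x + y) - f x) ∂(tail ρ N) := by
      rw [← head_add_tail ρ N] at hint
      rw [← integral_add_measure hint.left_of_add_measure hint.right_of_add_measure,
        head_add_tail]
    rw [e, add_sub_cancel_left]
    exact norm_integral_le_lip (tail ρ N) _ K (fun y => y) _ htail hlip' K.coe_nonneg le_rfl
  have c3 := cp_expansion (head ρ N) t f hf M hM ht x
  have c2' : |t * ((∫ y, (f (x + y) - f x) ∂ρ) - ∫ y, (f (x + y) - f x) ∂(head ρ N))| ≤
      K * (t * (∫⁻ y, ‖y‖ₑ ∂(tail ρ N)).toReal) := by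
    rw [abs_mul, abs_of_nonneg t.coe_nonneg]
    calc _ ≤ (t : ℝ) * (K * (∫⁻ y, ‖y‖ₑ ∂(tail ρ N)).toReal) :=
          mul_le_mul_of_nonneg_left c2 t.coe_nonneg
      _ = _ := by ring
  rw [abs_le] at *
  constructor <;> nlinarith [c1.1, c1.2, c2'.1, c2'.2, c3.1, c3.2]

/-- A jump measure with a finite first moment generates a Markov semigroup. -/
theorem isGenerated (ρ : Measure E) [SFinite ρ] (hρ : ∫⁻ y, ‖y‖ₑ ∂ρ ≠ ⊤) :
    IsMarkovSemigroupGeneratedBy (fun f x => ∫ y, (f (x + y) - f x) ∂ρ) (kernel ρ) where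
  isMarkovKernel t := by
    have := law_prob ρ hρ t
    unfold kernel
    exact Kernel.IsMarkovKernel.map _ (by fun_prop)
  zero := by
    ext1 x
    rw [kernel_apply ρ hρ, law_zero ρ hρ, Kernel.id_apply, Measure.conv_dirac]
    simp
  add s t := by
    have := law_prob ρ hρ s
    have := law_prob ρ hρ t
    have := law_prob ρ hρ (s + t)
    ext x B hB
    rw [Kernel.comp_apply' _ _ _ hB, kernel_apply ρ hρ, kernel_apply ρ hρ, law_add ρ hρ,
      ← Measure.conv_assoc, Measure.conv, Measure.map_apply (by fun_prop) hB,
      Measure.prod_apply (measurable_add hB)]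
    refine lintegral_congr fun b => ?_
    rw [kernel_apply ρ hρ, Measure.dirac_conv, Measure.map_apply (by fun_prop) hB]
    rfl
  generator f hf := by
    obtain ⟨M, hM⟩ := hf.2 0
    obtain ⟨K, hK⟩ := hf.2 1
    have hM' : ∀ x, |f x| ≤ M := fun x => by simpa using hM x
    have hM0 : 0 ≤ M := (abs_nonneg _).trans (hM' 0)
    have hK0 : 0 ≤ K := (norm_nonneg _).trans (hK 0)
    have hc : Continuous f := hf.1.continuous
    have hlip : LipschitzWith ⟨K, hK0⟩ f := by
      refine lipschitzWith_of_nnnorm_fderiv_le (𝕜 := ℝ) (hf.1.differentiable (by simp)) fun x => ?_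
      have := hK x
      rwa [norm_iteratedFDeriv_one] at this
    rw [Metric.tendstoUniformly_iff]
    intro ε hε
    have htl : Tendsto (fun N => K * (∫⁻ y, ‖y‖ₑ ∂(tail ρ N)).toReal) atTop (𝓝 (K * 0)) :=
      ((ENNReal.tendsto_toReal ENNReal.zero_ne_top).comp (tendsto_tail ρ hρ)).const_mul K
    rw [mul_zero] at htl
    obtain ⟨N, hN⟩ := (htl.eventually (gt_mem_nhds (by positivity : (0 : ℝ) < ε / 4))).exists
    set lam := (head ρ N).real Set.univ with hlam
    have hl0 : 0 ≤ lam := by positivity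
    have ht1 : Tendsto (fun t : ℝ≥0 => (t : ℝ) * lam) (𝓝[>] 0) (𝓝 0) := by
      have : Tendsto (fun t : ℝ≥0 => (t : ℝ) * lam) (𝓝 0) (𝓝 (((0 : ℝ≥0) : ℝ) * lam)) :=
        Continuous.tendsto (by fun_prop) 0
      simpa using this.mono_left nhdsWithin_le_nhds
    have ht2 : Tendsto (fun t : ℝ≥0 => 3 * M * lam ^ 2 * (t : ℝ)) (𝓝[>] 0) (𝓝 0) := by
      have : Tendsto (fun t : ℝ≥0 => 3 * M * lam ^ 2 * (t : ℝ)) (𝓝 0)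
          (𝓝 (3 * M * lam ^ 2 * ((0 : ℝ≥0) : ℝ))) :=
        Continuous.tendsto (by fun_prop) 0
      simpa using this.mono_left nhdsWithin_le_nhds
    filter_upwards [ht1.eventually (gt_mem_nhds one_pos),
      ht2.eventually (gt_mem_nhds (by positivity : (0 : ℝ) < ε / 2)), self_mem_nhdsWithin]
      with t h1 h2 h3 x
    have h3' : (0 : ℝ) < t := h3
    have hexp := law_expansion ρ hρ t N f hc M hM' ⟨K, hK0⟩ hlip h1.le x
    have hcf : Continuous fun y => f (x + y) := by fun_prop
    have := law_prob ρ hρ t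
    rw [kernel_apply ρ hρ, Measure.dirac_conv,
      integral_map (by fun_prop) hc.aestronglyMeasurable, dist_comm, Real.dist_eq]
    set I := ∫ y, f (x + y) ∂(law ρ t)
    set A := ∫ y, (f (x + y) - f x) ∂ρ
    have e : (I - f x) / t - A = (I - f x - t * A) / t := by field_simp
    rw [e, abs_div, abs_of_pos h3', div_lt_iff₀ h3']
    refine hexp.trans_lt ?_
    change 3 * M * (t * lam) ^ 2 + 2 * (K * (t * (∫⁻ y, ‖y‖ₑ ∂(tail ρ N)).toReal)) < ε * t
    nlinarith

end

end LevySemigroup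

lemma IsJumpDensity.aemeasurable {g : ℝ → ℝ} {C α : ℝ} (hg : IsJumpDensity g C α) :
    AEMeasurable g := by
  have h : AEMeasurable g (volume.restrict {0}ᶜ) :=
    hg.smooth.continuousOn.aemeasurable (measurableSet_singleton 0).compl
  rwa [restrict_compl_singleton] at h

lemma IsJumpDensity.integrable_abs_mul {g : ℝ → ℝ} {C α : ℝ} (hg : IsJumpDensity g C α) :
    Integrable fun z => |z| * g z := by
  obtain ⟨δ, hδ, hδg⟩ := Metric.eventually_nhds_iff.1 (eventually_nhdsWithin_iff.1 hg.near_zero)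
  have i1 : IntegrableOn (fun z : ℝ => C * |z| ^ (-α)) (Set.Icc (-1) 1) := by
    refine Integrable.const_mul ?_ C
    have hp : IntegrableOn (fun z : ℝ => z ^ (-α)) (Set.Ioc 0 1) := by
      rw [← intervalIntegrable_iff_integrableOn_Ioc_of_le zero_le_one]
      exact intervalIntegral.intervalIntegrable_rpow' (by linarith [hg.index_lt_one])
    have h1 : IntegrableOn (fun z : ℝ => |z| ^ (-α)) (Set.Ioc 0 1) :=
      hp.congr_fun (fun z hz => by simp only [abs_of_pos hz.1]) measurableSet_Ioc
    have h2 : IntervalIntegrable (fun z : ℝ => |z| ^ (-α)) volume 0 1 :=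
      (intervalIntegrable_iff_integrableOn_Ioc_of_le zero_le_one).2 h1
    have h3 : IntervalIntegrable (fun z : ℝ => |z| ^ (-α)) volume (-1) 0 := by
      have := h2.comp_sub_left 0
      simp only [zero_sub, abs_neg, sub_zero] at this
      exact this.symm
    exact (intervalIntegrable_iff_integrableOn_Icc_of_le (by norm_num)).1 (h3.trans h2)
  have i2 : Integrable ((Set.Icc (-1 : ℝ) 1).indicator fun z : ℝ => C * |z| ^ (-α)) :=
    i1.integrable_indicator measurableSet_Icc
  set e : ℝ := min δ 1 with he
  have he0 : 0 < e := by positivity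
  refine (i2.add (hg.integrable.const_mul (e ^ 2)⁻¹)).mono'
    (by have := hg.aemeasurable; exact AEMeasurable.aestronglyMeasurable (by fun_prop)) ?_
  filter_upwards [ae_iff.2 (by simp : volume {z : ℝ | ¬ z ≠ 0} = 0)] with z hz
  have hgz := hg.nonneg z hz
  have hz0 : 0 < |z| := abs_pos.2 hz
  have hind : 0 ≤ (Set.Icc (-1 : ℝ) 1).indicator (fun z : ℝ => C * |z| ^ (-α)) z :=
    Set.indicator_nonneg (fun z _ => mul_nonneg hg.const_pos.le (by positivity)) z
  rw [Real.norm_of_nonneg (by positivity), Pi.add_apply]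
  by_cases h1 : 1 < |z|
  · rw [hg.support z h1]; simpa using hind
  push Not at h1
  by_cases h2 : |z| < e
  · have h3 : g z = C / |z| ^ (1 + α) := by
      refine hδg ?_ hz
      rw [Real.dist_eq, sub_zero]
      exact h2.trans_le (min_le_left _ _)
    rw [Set.indicator_of_mem (by exact abs_le.1 h1)]
    have h4 : |z| * g z = C * |z| ^ (-α) := by
      rw [h3, Real.rpow_add hz0, Real.rpow_one, Real.rpow_neg hz0.le]
      field_simp
    rw [h4]
    have : 0 ≤ (e ^ 2)⁻¹ * (min (z ^ 2) 1 * g z) := by positivity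
    linarith
  · push Not at h2
    have h5 : e ^ 2 ≤ min (z ^ 2) 1 := by
      refine le_min ?_ ?_
      · rw [← sq_abs z]; gcongr
      · exact pow_le_one₀ he0.le (min_le_right _ _)
    have h6 : |z| * g z ≤ (e ^ 2)⁻¹ * (min (z ^ 2) 1 * g z) := by
      rw [← mul_assoc]
      refine mul_le_mul_of_nonneg_right (h1.trans ?_) hgz
      rw [inv_mul_eq_div, one_le_div (by positivity)]
      exact h5
    linarith

lemma continuous_sqForm {d : ℕ} : Continuous (sqForm : EuclideanSpace ℝ (Fin d) → SymMatrix d) := by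
  have h : Continuous fun v : EuclideanSpace ℝ (Fin d) => InnerProductSpace.rankOne ℝ v v := by
    have h0 : Continuous fun v : EuclideanSpace ℝ (Fin d) =>
        InnerProductSpace.rankOne ℝ (F := EuclideanSpace ℝ (Fin d)) v :=
      ContinuousLinearMap.continuous _
    exact h0.clm_apply continuous_id
  exact (SymMatrix.toCLM (d := d)).isometry.comp_continuous_iff.1 h

lemma continuous_malliavinJump {d : ℕ} {γ : ℝ → EuclideanSpace ℝ (Fin d)} {ν : ℝ → ℝ}
    (hγ : IsJumpCurve γ) (hν : IsJumpWeight ν) : Continuous (malliavinJump γ ν) := by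
  have h1 : Continuous (deriv γ) := hγ.smooth.continuous_deriv (by simp)
  exact hγ.smooth.continuous.prodMk (hν.smooth.continuous.smul (continuous_sqForm.comp h1))

lemma norm_malliavinJump_le {d : ℕ} {γ : ℝ → EuclideanSpace ℝ (Fin d)} {ν : ℝ → ℝ}
    (hγ : IsJumpCurve γ) (hν : IsJumpWeight ν) :
    ∃ K : ℝ, 0 ≤ K ∧ ∀ w, ‖malliavinJump γ ν w‖ ≤ K * |w| := by
  obtain ⟨B, hB⟩ := hγ.bounded 1 le_rfl
  simp only [iteratedDeriv_one] at hB
  have hB0 : 0 ≤ B := (norm_nonneg _).trans (hB 0)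
  have h1 : ∀ w, ‖γ w‖ ≤ B * |w| := fun w => by
    have := Convex.norm_image_sub_le_of_norm_deriv_le (s := Set.univ) (x := 0) (y := w)
      (fun x _ => (hγ.smooth.differentiable (by simp)) x) (fun x _ => hB x) convex_univ
      trivial trivial
    simpa [hγ.zero] using this
  obtain ⟨D, hD⟩ := (hν.smooth.continuous_deriv (by simp)).bounded_above_of_compact_support
    hν.compact.deriv
  have hD0 : 0 ≤ D := (norm_nonneg _).trans (hD 0)
  have hν0 : ν 0 = 0 := by simpa using hν.near_zero.self_of_nhds
  have h2 : ∀ w, ‖ν w‖ ≤ D * |w| := fun w => by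
    have := Convex.norm_image_sub_le_of_norm_deriv_le (s := Set.univ) (x := 0) (y := w)
      (fun x _ => (hν.smooth.differentiable (by simp)) x) (fun x _ => hD x) convex_univ
      trivial trivial
    simpa [hν0] using this
  refine ⟨max B (D * B ^ 2), le_max_of_le_left hB0, fun w => ?_⟩
  rw [malliavinJump, Prod.norm_mk]
  refine max_le ((h1 w).trans ?_) ?_
  · gcongr; exact le_max_left _ _
  · have h3 : ‖sqForm (deriv γ w)‖ ≤ B ^ 2 := by
      change ‖InnerProductSpace.rankOne ℝ (deriv γ w) (deriv γ w)‖ ≤ B ^ 2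
      rw [InnerProductSpace.norm_rankOne, ← sq]
      gcongr
      exact hB w
    rw [norm_smul]
    calc ‖ν w‖ * ‖sqForm (deriv γ w)‖ ≤ (D * |w|) * B ^ 2 := by
          gcongr; exact h2 w
      _ = (D * B ^ 2) * |w| := by ring
      _ ≤ _ := by gcongr; exact le_max_right _ _

/-- For every `h > 0` the operator `(1 / h) L̂^h` does generate a Markov semigroup. -/
theorem exists_malliavinSemigroup {d : ℕ} {g : ℝ → ℝ} {C α : ℝ} (hg : IsJumpDensity g C α)
    {γ : ℝ → EuclideanSpace ℝ (Fin d)} (hγ : IsJumpCurve γ) {ν : ℝ → ℝ} (hν : IsJumpWeight ν)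
    {h : ℝ} (hh : 0 < h) : ∃ P : ℝ≥0 → Kernel (MalliavinSpace d) (MalliavinSpace d),
      IsMarkovSemigroupGeneratedBy (malliavinGenerator γ ν g h) P := by
  set G : ℝ → MalliavinSpace d := fun z => malliavinJump γ ν (h * z) with hG
  have hGc : Continuous G := (continuous_malliavinJump hγ hν).comp (by fun_prop)
  set q : ℝ → ℝ≥0∞ := fun z => ENNReal.ofReal (h⁻¹ * g z) with hq
  have hqm : AEMeasurable q := by have := hg.aemeasurable; fun_prop
  set ρ : Measure (MalliavinSpace d) := (volume.withDensity q).map G with hρ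
  obtain ⟨K, hK0, hK⟩ := norm_malliavinJump_le hγ hν
  have hne : ∀ᵐ z : ℝ, z ≠ 0 := ae_iff.2 (by simp : volume {z : ℝ | ¬ z ≠ 0} = 0)
  have hfin : ∫⁻ y, ‖y‖ₑ ∂ρ ≠ ⊤ := by
    rw [hρ, lintegral_map (by fun_prop) hGc.measurable,
      lintegral_withDensity_eq_lintegral_mul₀ hqm (by fun_prop)]
    have hi := (hg.integrable_abs_mul.const_mul K).2
    refine (lt_of_le_of_lt (lintegral_mono_ae ?_) hi).ne
    filter_upwards [hne] with z hz
    have hgz := hg.nonneg z hz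
    rw [Pi.mul_apply, hq, ← ofReal_norm, ← ofReal_norm, ← ENNReal.ofReal_mul (by positivity)]
    refine ENNReal.ofReal_le_ofReal ?_
    rw [Real.norm_of_nonneg (by positivity)]
    calc h⁻¹ * g z * ‖G z‖ ≤ h⁻¹ * g z * (K * |h * z|) := by gcongr; exact hK _
      _ = K * (|z| * g z) := by rw [abs_mul, abs_of_pos hh]; field_simp
  have hA : ∀ f : MalliavinSpace d → ℝ, IsSmoothBounded f →
      malliavinGenerator γ ν g h f = fun x => ∫ y, (f (x + y) - f x) ∂ρ := by
    intro f hf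
    have hc : Continuous f := hf.1.continuous
    ext x
    rw [hρ, integral_map hGc.measurable.aemeasurable
      (by fun_prop : Continuous fun y => f (x + y) - f x).aestronglyMeasurable,
      integral_withDensity_eq_integral_toReal_smul₀ hqm (ae_of_all _ fun z => by simp [hq]),
      malliavinGenerator, ← integral_const_mul]
    refine integral_congr_ae ?_
    filter_upwards [hne] with z hz
    have hgz := hg.nonneg z hz
    rw [hq, ENNReal.toReal_ofReal (by positivity), smul_eq_mul]
    ring
  have hgen := LevySemigroup.isGenerated ρ hfin
  exact ⟨LevySemigroup.kernel ρ, hgen.isMarkovKernel, hgen.zero, hgen.add, fun f hf => by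
    rw [hA f hf]; exact hgen.generator f hf⟩

/-!
A translation invariant pure jump operator generates at most one Markov semigroup: its characters
solve a linear differential equation (`LevySemigroup.eq_kernel_of_generated`). Hence
`P t (x, 0)` is the law of `(x, 0) + Y` with `Y = (X, V)` the Lévy variable with jump measure
`jumpMeasure γ ν g h`, and the upper half of the Lévy-Khintchine formula holds for exponential
moments of linear functionals of `Y` (`LevySemigroup.lintegral_exp_law_le`).

The matrix `V` is a limit of sums of nonnegative multiples of rank one projections, so it is
nonnegative and dominated by its trace. For such matrices `V^{-p}` is at most a constant plus a
multiple of `∫ ‖ξ‖^(2p) exp (2 tr V - ⟪ξ, V ξ⟫) dξ` (`invNormPow_le`). The integrand is the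
exponential of a linear functional of `V`, so its expectation is at most
`exp (t (A - Ψ_h ξ))`, where `A` bounds the exponent of `exp (2 tr V)` uniformly in `h`, and
`Ψ_h ξ` is the Laplace exponent of `⟪ξ, V ξ⟫`.

It remains to bound `Ψ_h ξ` from below. By the span condition and compactness of the sphere of
Taylor coefficients, `w ↦ w⁴ ⟪ξ, γ'(w)⟫²` is bounded below in the mean over `[η / 2, η]` once
`‖ξ‖ η^(k + 2)` is large (`exists_nondegenerate`). The choice `η ∼ ‖ξ‖^(-1 / (k + 2))` is
allowed if `η` is at most a multiple of `h`, and it gives `Ψ_h ξ ≥ c ‖ξ‖^(α / (k + 2))` for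
`‖ξ‖ ≥ R h^(-(k + 2))` (`exists_laplace_lower_bound`). Outside this ball the integral over `ξ`
converges, with a bound that depends on `t`; the ball itself contributes the power
`h^(-(k + 2) (2 p + d))`, whose exponent does not depend on `t`.
-/

open scoped RealInnerProductSpace

/-! ### Uniqueness of the semigroup -/

lemma norm_iteratedDeriv_sin_cos_le (k : ℕ) :
    (∀ x, ‖iteratedDeriv k Real.sin x‖ ≤ 1) ∧ ∀ x, ‖iteratedDeriv k Real.cos x‖ ≤ 1 := by
  induction k with
  | zero => exact ⟨fun x => by simpa using Real.abs_sin_le_one x,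
      fun x => by simpa using Real.abs_cos_le_one x⟩
  | succ k ih =>
    refine ⟨fun x => ?_, fun x => ?_⟩
    · rw [Real.iteratedDeriv_add_one_sin]; exact ih.2 x
    · rw [Real.iteratedDeriv_add_one_cos]; simpa using ih.1 x

lemma IsSmoothBounded.comp_dual {E : Type*} [NormedAddCommGroup E] [NormedSpace ℝ E] {f : ℝ → ℝ}
    (hf : IsSmoothBounded f) (L : StrongDual ℝ E) : IsSmoothBounded fun x => f (L x) := by
  refine ⟨hf.1.comp L.contDiff, fun k => ?_⟩
  obtain ⟨B, hB⟩ := hf.2 k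
  refine ⟨B * ‖L‖ ^ k, fun x => ?_⟩
  have h := L.iteratedFDeriv_comp_right hf.1 x (i := k) (by exact_mod_cast le_top)
  rw [show (fun x => f (L x)) = f ∘ L from rfl, h]
  refine (ContinuousMultilinearMap.norm_compContinuousLinearMap_le _ _).trans ?_
  simp only [Finset.prod_const, Finset.card_univ, Fintype.card_fin]
  gcongr
  exact hB _

lemma isSmoothBounded_cos : IsSmoothBounded Real.cos :=
  ⟨Real.contDiff_cos, fun k => ⟨1, fun x => by
    rw [norm_iteratedFDeriv_eq_norm_iteratedDeriv]; exact (norm_iteratedDeriv_sin_cos_le k).2 x⟩⟩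

lemma isSmoothBounded_sin : IsSmoothBounded Real.sin :=
  ⟨Real.contDiff_sin, fun k => ⟨1, fun x => by
    rw [norm_iteratedFDeriv_eq_norm_iteratedDeriv]; exact (norm_iteratedDeriv_sin_cos_le k).1 x⟩⟩

lemma integral_ofReal_add_mul_I {Ω : Type*} [MeasurableSpace Ω] {μ : Measure Ω} {f₁ f₂ : Ω → ℝ}
    (h₁ : Integrable f₁ μ) (h₂ : Integrable f₂ μ) :
    ∫ w, ((f₁ w : ℂ) + f₂ w * Complex.I) ∂μ = (∫ w, f₁ w ∂μ : ℝ) + (∫ w, f₂ w ∂μ : ℝ) * Complex.I := by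
  rw [integral_add h₁.ofReal (h₂.ofReal.mul_const _), integral_mul_const, integral_complex_ofReal,
    integral_complex_ofReal]

namespace LevySemigroup

section Uniqueness

variable {E : Type*} [NormedAddCommGroup E] [NormedSpace ℝ E] [MeasurableSpace E] [BorelSpace E]
  [SecondCountableTopology E]

set_option linter.unusedSectionVars false

/-- The Lévy exponent `L ↦ ∫ (exp (i L y) - 1) ρ(dy)` of the jump measure `ρ`. -/
noncomputable def levyExponent (ρ : Measure E) (L : StrongDual ℝ E) : ℂ :=
  ∫ y, (Complex.exp (L y * Complex.I) - 1) ∂ρ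

lemma integrable_comp_sub {ρ : Measure E} (hρ : ∫⁻ y, ‖y‖ₑ ∂ρ ≠ ⊤) {f : E → ℝ} {K : ℝ≥0}
    (hK : LipschitzWith K f) (x : E) : Integrable (fun y => f (x + y) - f x) ρ := by
  have hi : Integrable (fun y : E => (K : ℝ) * ‖y‖) ρ :=
    (Integrable.norm ⟨by fun_prop, hρ.lt_top⟩).const_mul _
  have hf : Continuous f := hK.continuous
  refine hi.mono' (by fun_prop : Continuous fun y => f (x + y) - f x).aestronglyMeasurable
    (ae_of_all _ fun y => ?_)
  simpa [dist_eq_norm] using hK.dist_le_mul (x + y) x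

lemma exp_mul_levyExponent {ρ : Measure E} (hρ : ∫⁻ y, ‖y‖ₑ ∂ρ ≠ ⊤) (L : StrongDual ℝ E) (x : E) :
    levyExponent ρ L * Complex.exp (L x * Complex.I) =
      (∫ y, (Real.cos (L (x + y)) - Real.cos (L x)) ∂ρ : ℝ) +
        (∫ y, (Real.sin (L (x + y)) - Real.sin (L x)) ∂ρ : ℝ) * Complex.I := by
  rw [← integral_ofReal_add_mul_I, levyExponent, ← integral_mul_const]
  · refine integral_congr_ae (ae_of_all _ fun y => ?_)
    simp only [map_add]
    rw [sub_mul, ← Complex.exp_add, ← add_mul, add_comm (L y : ℂ), ← Complex.ofReal_add,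
      Complex.exp_mul_I, one_mul, Complex.exp_mul_I]
    push_cast
    ring
  · exact integrable_comp_sub (f := fun y => Real.cos (L y)) hρ
      ((Real.lipschitzWith_cos).comp L.lipschitz) x
  · exact integrable_comp_sub (f := fun y => Real.sin (L y)) hρ
      ((Real.lipschitzWith_sin).comp L.lipschitz) x

/-- The generator acts on the character `exp (i L)` as multiplication by the Lévy exponent. -/
lemma charFunDual_short_time {ρ : Measure E} (hρ : ∫⁻ y, ‖y‖ₑ ∂ρ ≠ ⊤) {P : ℝ≥0 → Kernel E E}
    (hP : IsMarkovSemigroupGeneratedBy (fun f x => ∫ y, (f (x + y) - f x) ∂ρ) P)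
    (L : StrongDual ℝ E) {ε : ℝ} (hε : 0 < ε) :
    ∃ δ : ℝ, 0 < δ ∧ ∀ s : ℝ≥0, 0 < s → (s : ℝ) < δ → ∀ x,
      ‖charFunDual (P s x) L - Complex.exp (L x * Complex.I) -
        s * (levyExponent ρ L * Complex.exp (L x * Complex.I))‖ ≤ ε * s := by
  have hc := Metric.tendstoUniformly_iff.1 (hP.generator _ (isSmoothBounded_cos.comp_dual L)) (ε / 2)
    (by positivity)
  have hs := Metric.tendstoUniformly_iff.1 (hP.generator _ (isSmoothBounded_sin.comp_dual L)) (ε / 2)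
    (by positivity)
  obtain ⟨δ, hδ, h⟩ := Metric.eventually_nhds_iff.1 (eventually_nhdsWithin_iff.1 (hc.and hs))
  refine ⟨δ, hδ, fun s hs0 hsδ x => ?_⟩
  obtain ⟨h1, h2⟩ := h (y := s) (by simpa [NNReal.dist_eq] using hsδ) hs0
  specialize h1 x
  specialize h2 x
  have := hP.isMarkovKernel s
  have hs0' : (0 : ℝ) < s := hs0
  have e : charFunDual (P s x) L = (∫ y, Real.cos (L y) ∂(P s x) : ℝ) +
      (∫ y, Real.sin (L y) ∂(P s x) : ℝ) * Complex.I := by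
    rw [← integral_ofReal_add_mul_I, charFunDual_apply]
    · refine integral_congr_ae (ae_of_all _ fun y => ?_)
      simp only [Complex.exp_mul_I, Complex.ofReal_cos, Complex.ofReal_sin]
    · exact (integrable_const (1 : ℝ)).mono' (by fun_prop)
        (ae_of_all _ fun y => Real.abs_cos_le_one _)
    · exact (integrable_const (1 : ℝ)).mono' (by fun_prop)
        (ae_of_all _ fun y => Real.abs_sin_le_one _)
  rw [Real.dist_eq, abs_sub_comm] at h1 h2
  rw [exp_mul_levyExponent hρ, e, Complex.exp_mul_I]
  refine (Complex.norm_le_abs_re_add_abs_im _).trans ?_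
  simp only [Complex.add_re, Complex.sub_re, Complex.mul_re, Complex.add_im, Complex.sub_im,
    Complex.mul_im, Complex.ofReal_re, Complex.ofReal_im, Complex.I_re, Complex.I_im,
    ← Complex.ofReal_cos, ← Complex.ofReal_sin]
  have key : ∀ a b : ℝ, |a / s - b| < ε / 2 → |a - s * b| ≤ ε / 2 * s := fun a b hab => by
    have : a - s * b = (a / s - b) * s := by field_simp
    rw [this, abs_mul, abs_of_pos hs0']
    gcongr
  have k1 := key _ _ h1
  have k2 := key _ _ h2
  simp only [mul_zero, mul_one, zero_mul, sub_zero, add_zero, zero_add]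
  linarith

/-- By the Chapman-Kolmogorov equation, the short time expansion holds along the semigroup,
uniformly in the time `t`. -/
lemma charFunDual_increment {ρ : Measure E} (hρ : ∫⁻ y, ‖y‖ₑ ∂ρ ≠ ⊤) {P : ℝ≥0 → Kernel E E}
    (hP : IsMarkovSemigroupGeneratedBy (fun f x => ∫ y, (f (x + y) - f x) ∂ρ) P)
    (L : StrongDual ℝ E) (x : E) {ε : ℝ} (hε : 0 < ε) :
    ∃ δ : ℝ, 0 < δ ∧ ∀ s : ℝ≥0, 0 < s → (s : ℝ) < δ → ∀ t,
      ‖charFunDual (P (s + t) x) L - charFunDual (P t x) L -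
        s * (levyExponent ρ L * charFunDual (P t x) L)‖ ≤ ε * s := by
  obtain ⟨δ, hδ, h⟩ := charFunDual_short_time hρ hP L hε
  refine ⟨δ, hδ, fun s hs0 hsδ t => ?_⟩
  have := hP.isMarkovKernel s
  have := hP.isMarkovKernel t
  have := hP.isMarkovKernel (s + t)
  have hi : ∀ (μ : Measure E) [IsFiniteMeasure μ],
      Integrable (fun v : E => Complex.exp (L v * Complex.I)) μ := fun μ _ =>
    (integrable_const (1 : ℝ)).mono (by fun_prop) (by simp)
  have e1 : charFunDual (P (s + t) x) L = ∫ b, charFunDual (P s b) L ∂(P t x) := by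
    have : IsFiniteMeasure ((P s ∘ₖ P t) x) := inferInstance
    rw [hP.add, charFunDual_apply, Kernel.integral_comp (hi _)]
    rfl
  have hi1 : Integrable (fun b => charFunDual (P s b) L) (P t x) := by
    have : IsFiniteMeasure ((P s ∘ₖ P t) x) := inferInstance
    exact (hi ((P s ∘ₖ P t) x)).integral_comp
  rw [e1, charFunDual_apply (μ := P t x), ← integral_sub hi1 (hi _), ← integral_const_mul,
    ← integral_const_mul, ← integral_sub (f := fun b => charFunDual (P s b) L - Complex.exp (L b * Complex.I))
      (hi1.sub (hi _)) (((hi _).const_mul _).const_mul _)]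
  refine (norm_integral_le_of_norm_le_const (ae_of_all _ fun b => h s hs0 hsδ b)).trans ?_
  simp

lemma uniformContinuous_charFunDual {ρ : Measure E} (hρ : ∫⁻ y, ‖y‖ₑ ∂ρ ≠ ⊤)
    {P : ℝ≥0 → Kernel E E}
    (hP : IsMarkovSemigroupGeneratedBy (fun f x => ∫ y, (f (x + y) - f x) ∂ρ) P)
    (L : StrongDual ℝ E) (x : E) : UniformContinuous fun t => charFunDual (P t x) L := by
  obtain ⟨δ, hδ, h⟩ := charFunDual_increment hρ hP L x one_pos
  set D := ‖levyExponent ρ L‖ + 1 with hD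
  have hD0 : 0 < D := by positivity
  rw [Metric.uniformContinuous_iff]
  intro ε hε
  refine ⟨min δ (ε / D), by positivity, ?_⟩
  intro a b hab
  wlog hle : a ≤ b generalizing a b
  · rw [dist_comm]
    exact this (by rwa [dist_comm]) (le_of_not_ge hle)
  rcases hle.eq_or_lt with rfl | hlt
  · simpa using hε
  obtain ⟨s, rfl⟩ := exists_add_of_le hle
  rw [add_comm] at hlt hab ⊢
  have hs0 : 0 < s := by simpa using hlt
  have hs : (s : ℝ) < min δ (ε / D) := by
    simpa [NNReal.dist_eq] using hab
  have h1 := h s hs0 (hs.trans_le (min_le_left _ _)) a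
  have := hP.isMarkovKernel a
  have h2 : ‖charFunDual (P a x) L‖ ≤ 1 := by
    rw [charFunDual_apply]
    refine (norm_integral_le_of_norm_le_const (C := 1) (ae_of_all _ fun v => ?_)).trans (by simp)
    rw [Complex.norm_exp_ofReal_mul_I]
  rw [dist_comm, dist_eq_norm]
  have h3 : ‖(s : ℂ) * (levyExponent ρ L * charFunDual (P a x) L)‖ ≤ s * ‖levyExponent ρ L‖ := by
    rw [norm_mul, norm_mul]
    have : ‖(s : ℂ)‖ = s := by simp
    rw [this]
    gcongr
    exact mul_le_of_le_one_right (norm_nonneg _) h2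
  calc _ ≤ ‖charFunDual (P (s + a) x) L - charFunDual (P a x) L -
        s * (levyExponent ρ L * charFunDual (P a x) L)‖ +
        ‖(s : ℂ) * (levyExponent ρ L * charFunDual (P a x) L)‖ := norm_le_norm_sub_add _ _
    _ ≤ 1 * s + s * ‖levyExponent ρ L‖ := add_le_add h1 h3
    _ = D * s := by rw [hD]; ring
    _ < D * (ε / D) := by gcongr; exact hs.trans_le (min_le_right _ _)
    _ = ε := by field_simp

/-- The characteristic function of a semigroup generated by a translation invariant pure jump
operator: along the semigroup it solves a linear differential equation. -/
lemma charFunDual_of_generated {ρ : Measure E} (hρ : ∫⁻ y, ‖y‖ₑ ∂ρ ≠ ⊤) {P : ℝ≥0 → Kernel E E}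
    (hP : IsMarkovSemigroupGeneratedBy (fun f x => ∫ y, (f (x + y) - f x) ∂ρ) P)
    (L : StrongDual ℝ E) (x : E) (t : ℝ≥0) :
    charFunDual (P t x) L =
      Complex.exp (t * levyExponent ρ L) * Complex.exp (L x * Complex.I) := by
  set ψ := levyExponent ρ L with hψ
  set v : ℝ → ℂ := fun r => charFunDual (P r.toNNReal x) L with hv
  have hvc : Continuous v :=
    (uniformContinuous_charFunDual hρ hP L x).continuous.comp continuous_real_toNNReal
  have hvd : ∀ r, 0 ≤ r → HasDerivWithinAt v (ψ * v r) (Set.Ici r) r := by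
    intro r hr
    rw [← hasDerivWithinAt_Ioi_iff_Ici, hasDerivWithinAt_iff_tendsto_slope' (by simp),
      Metric.tendsto_nhdsWithin_nhds]
    intro ε hε
    obtain ⟨δ, hδ, h⟩ := charFunDual_increment hρ hP L x (half_pos hε)
    refine ⟨δ, hδ, fun {q} hq hqδ => ?_⟩
    have hq' : r < q := hq
    obtain ⟨s, hs⟩ : ∃ s : ℝ≥0, (s : ℝ) = q - r := ⟨⟨q - r, by linarith⟩, rfl⟩
    have hs0 : (0 : ℝ) < s := by rw [hs]; linarith
    have hadd : q.toNNReal = s + r.toNNReal := by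
      rw [show q = (s : ℝ) + r by rw [hs]; ring, Real.toNNReal_add s.coe_nonneg hr,
        Real.toNNReal_coe]
    have h1 := h s hs0 (by rwa [hs, ← abs_of_pos (by linarith : 0 < q - r), ← Real.dist_eq])
      r.toNNReal
    rw [← hadd] at h1
    rw [dist_eq_norm, slope_def_module, ← hs]
    have e : (s : ℝ)⁻¹ • (v q - v r) - ψ * v r =
        (s : ℝ)⁻¹ • (v q - v r - s * (ψ * v r)) := by
      have : (s : ℂ) ≠ 0 := by exact_mod_cast hs0.ne'
      simp only [Complex.real_smul, Complex.ofReal_inv]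
      change (s : ℂ)⁻¹ * _ - _ = (s : ℂ)⁻¹ * _
      field_simp
    rw [e, norm_smul, norm_inv, Real.norm_of_nonneg hs0.le, inv_mul_lt_iff₀ hs0]
    refine h1.trans_lt ?_
    nlinarith
  have hE : ∀ r : ℝ, HasDerivAt (fun r : ℝ => Complex.exp (-(r * ψ)))
      (Complex.exp (-(r * ψ)) * -(1 * ψ)) r := fun r =>
    ((Complex.ofRealCLM.hasDerivAt.mul_const ψ).neg).cexp
  have hF := constant_of_has_deriv_right_zero (f := fun r : ℝ => Complex.exp (-(r * ψ)) * v r)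
    (a := 0) (b := t) (by fun_prop) (fun r hr => by
      exact ((hE r).hasDerivWithinAt.mul (hvd r hr.1)).congr_deriv (by ring)) t ⟨t.2, le_rfl⟩
  have h0 : v 0 = Complex.exp (L x * Complex.I) := by
    simp [hv, hP.zero, Kernel.id_apply, charFunDual_dirac]
  simp only [h0, Complex.ofReal_zero, zero_mul, neg_zero, Complex.exp_zero, one_mul] at hF
  rw [← hF, ← mul_assoc, ← Complex.exp_add]
  simp [hv]

/-- A translation invariant pure jump operator generates at most one Markov semigroup, which is
therefore `LevySemigroup.kernel`. -/
theorem eq_kernel_of_generated [CompleteSpace E] (ρ : Measure E) [SFinite ρ]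
    (hρ : ∫⁻ y, ‖y‖ₑ ∂ρ ≠ ⊤) {P : ℝ≥0 → Kernel E E}
    (hP : IsMarkovSemigroupGeneratedBy (fun f x => ∫ y, (f (x + y) - f x) ∂ρ) P) (t : ℝ≥0) (x : E) :
    P t x = kernel ρ t x := by
  have hQ := isGenerated ρ hρ
  have := hP.isMarkovKernel t
  have := hQ.isMarkovKernel t
  refine Measure.ext_of_charFunDual ?_
  ext L
  rw [charFunDual_of_generated hρ hP, charFunDual_of_generated hρ hQ]

end Uniqueness

end LevySemigroup

/-! ### Exponential moments and support of the law -/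

namespace LevySemigroup

section Moments

variable {E : Type*} [NormedAddCommGroup E] [NormedSpace ℝ E] [MeasurableSpace E] [BorelSpace E]
  [SecondCountableTopology E] [CompleteSpace E]

set_option linter.unusedSectionVars false

lemma lintegral_exp_convPow (ρ : Measure E) [IsFiniteMeasure ρ] (L : StrongDual ℝ E) (k : ℕ) :
    ∫⁻ y, ENNReal.ofReal (Real.exp (L y)) ∂(convPow ρ k) =
      (∫⁻ y, ENNReal.ofReal (Real.exp (L y)) ∂ρ) ^ k := by
  induction k with
  | zero => simp [convPow]
  | succ k ih =>
    rw [convPow, Measure.lintegral_conv (by fun_prop)]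
    simp_rw [map_add, Real.exp_add, ENNReal.ofReal_mul (Real.exp_nonneg _)]
    simp_rw [lintegral_const_mul' _ _ ENNReal.ofReal_ne_top]
    rw [lintegral_mul_const _ (by fun_prop), ih, pow_succ]

lemma lintegral_exp_cp (ρ : Measure E) [IsFiniteMeasure ρ] (t : ℝ≥0) (L : StrongDual ℝ E)
    (hL : Integrable (fun y => Real.exp (L y) - 1) ρ) :
    ∫⁻ y, ENNReal.ofReal (Real.exp (L y)) ∂(cp ρ t) =
      ENNReal.ofReal (Real.exp (t * ∫ y, (Real.exp (L y) - 1) ∂ρ)) := by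
  have hi : Integrable (fun y => Real.exp (L y)) ρ := by
    exact (hL.add (integrable_const (1 : ℝ))).congr (ae_of_all _ fun y => by simp)
  set m := ∫ y, Real.exp (L y) ∂ρ with hm
  have hm0 : 0 ≤ m := integral_nonneg fun y => (Real.exp_pos _).le
  have e1 : ∫⁻ y, ENNReal.ofReal (Real.exp (L y)) ∂ρ = ENNReal.ofReal m :=
    (ofReal_integral_eq_lintegral_ofReal hi (ae_of_all _ fun y => (Real.exp_pos _).le)).symm
  have e2 : ∫ y, (Real.exp (L y) - 1) ∂ρ = m - ρ.real Set.univ := by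
    rw [integral_sub hi (integrable_const _)]; simp [hm]
  have hs := (NormedSpace.expSeries_div_hasSum_exp (𝔸 := ℝ) (t * m)).mul_left
    (Real.exp (-(t * ρ.real Set.univ)))
  rw [← Real.exp_eq_exp_ℝ, ← Real.exp_add] at hs
  rw [cp, lintegral_sum_measure]
  simp_rw [lintegral_smul_measure, lintegral_exp_convPow, e1, smul_eq_mul,
    ← ENNReal.ofReal_pow hm0]
  rw [e2, show (t : ℝ) * (m - ρ.real Set.univ) = -(t * ρ.real Set.univ) + t * m by ring,
    ← hs.tsum_eq, ENNReal.ofReal_tsum_of_nonneg (fun k => by positivity) hs.summable]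
  refine tsum_congr fun k => ?_
  rw [← ENNReal.ofReal_mul (by positivity)]
  congr 1
  rw [mul_pow]
  ring

lemma tendsto_integral_head {ρ : Measure E} [SFinite ρ] {f : E → ℝ} (hf : Integrable f ρ) :
    Tendsto (fun N => ∫ y, f y ∂(head ρ N)) atTop (𝓝 (∫ y, f y ∂ρ)) := by
  have hf' : Integrable f (Measure.sum (sfiniteSeq ρ)) := by rwa [sum_sfiniteSeq]
  have h := (hasSum_integral_measure hf').tendsto_sum_nat
  rw [sum_sfiniteSeq] at h
  refine h.congr fun N => ?_
  rw [head, integral_finsetSum_measure]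
  exact fun n _ => hf.mono_measure (sfiniteSeq_le ρ n)

lemma head_le (ρ : Measure E) [SFinite ρ] (N : ℕ) : head ρ N ≤ ρ := by
  conv_rhs => rw [← head_add_tail ρ N]
  exact Measure.le_add_right le_rfl

/-- Upper half of the Lévy-Khintchine formula for exponential moments; passing to the limit in the
compound Poisson case, Fatou's lemma gives an inequality, which is all that is needed. -/
lemma lintegral_exp_law_le (ρ : Measure E) [SFinite ρ] (hρ : ∫⁻ y, ‖y‖ₑ ∂ρ ≠ ⊤) (t : ℝ≥0)
    (L : StrongDual ℝ E) (hL : Integrable (fun y => Real.exp (L y) - 1) ρ) :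
    ∫⁻ y, ENNReal.ofReal (Real.exp (L y)) ∂(law ρ t) ≤
      ENNReal.ofReal (Real.exp (t * ∫ y, (Real.exp (L y) - 1) ∂ρ)) := by
  have hm : Measurable fun y : E => ENNReal.ofReal (Real.exp (L y)) := by fun_prop
  have hc : Continuous fun y : E => ENNReal.ofReal (Real.exp (L y)) :=
    ENNReal.continuous_ofReal.comp (by fun_prop)
  have hS : ∀ N : ℕ, Measurable fun w : ℕ → E => ∑ n ∈ Finset.range N, w n := fun N => by fun_prop
  rw [law, lintegral_map' hm.aemeasurable (aemeasurable_tsum ρ hρ t)]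
  have h1 : ∫⁻ w, ENNReal.ofReal (Real.exp (L (∑' n, w n))) ∂(joint ρ t) =
      ∫⁻ w, liminf (fun N => ENNReal.ofReal (Real.exp (L (∑ n ∈ Finset.range N, w n)))) atTop
        ∂(joint ρ t) := by
    refine lintegral_congr_ae ?_
    filter_upwards [ae_summable ρ hρ t] with w hw
    exact (((hc.tendsto _).comp hw.of_norm.hasSum.tendsto_sum_nat).liminf_eq).symm
  rw [h1]
  refine (lintegral_liminf_le fun N => hm.comp (hS N)).trans (le_of_eq ?_)
  have h2 : ∀ N : ℕ, ∫⁻ w, ENNReal.ofReal (Real.exp (L (∑ n ∈ Finset.range N, w n))) ∂(joint ρ t) =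
      ENNReal.ofReal (Real.exp (t * ∫ y, (Real.exp (L y) - 1) ∂(head ρ N))) := fun N => by
    rw [← lintegral_exp_cp _ _ _ (hL.mono_measure (head_le ρ N)), ← map_partial,
      lintegral_map hm (hS N)]
  refine (liminf_congr (Eventually.of_forall h2)).trans
    (Tendsto.liminf_eq (ENNReal.tendsto_ofReal ?_))
  exact (Real.continuous_exp.tendsto _).comp ((tendsto_integral_head hL).const_mul _)

lemma ae_mem_convPow {ρ : Measure E} [IsFiniteMeasure ρ] {S : AddSubmonoid E}
    (hS : IsClosed (S : Set E)) (hρS : ∀ᵐ y ∂ρ, y ∈ S) (k : ℕ) : ∀ᵐ y ∂(convPow ρ k), y ∈ S := by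
  induction k with
  | zero =>
    rw [convPow]
    exact (ae_dirac_iff hS.measurableSet).2 S.zero_mem
  | succ k ih =>
    rw [convPow, Measure.conv]
    refine (ae_map_iff (by fun_prop) hS.measurableSet).2 ?_
    filter_upwards [Measure.quasiMeasurePreserving_fst.ae ih,
      Measure.quasiMeasurePreserving_snd.ae hρS] with p h1 h2
    exact S.add_mem h1 h2

/-- The law is supported in every closed additive submonoid that supports the jump measure. -/
lemma ae_mem_law {ρ : Measure E} [SFinite ρ] (hρ : ∫⁻ y, ‖y‖ₑ ∂ρ ≠ ⊤) (t : ℝ≥0)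
    {S : AddSubmonoid E} (hS : IsClosed (S : Set E)) (hρS : ∀ᵐ y ∂ρ, y ∈ S) :
    ∀ᵐ y ∂(law ρ t), y ∈ S := by
  have h1 : ∀ n, ∀ᵐ y ∂(cp (sfiniteSeq ρ n) t), y ∈ S := fun n => by
    rw [cp]
    refine Measure.ae_sum_iff.2 fun k => Measure.ae_smul_measure ?_ _
    exact ae_mem_convPow hS ((Measure.absolutelyContinuous_of_le (sfiniteSeq_le ρ n)).ae_le hρS) k
  have h2 : ∀ᵐ w ∂(joint ρ t), ∀ n, w n ∈ S := by
    refine ae_all_iff.2 fun n => ?_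
    have hn : (joint ρ t).map (fun w => w n) = cp (sfiniteSeq ρ n) t :=
      Measure.infinitePi_map_eval _ n
    have := h1 n
    rw [← hn] at this
    exact ae_of_ae_map (measurable_pi_apply n).aemeasurable this
  rw [law]
  refine (ae_map_iff (aemeasurable_tsum ρ hρ t) hS.measurableSet).2 ?_
  filter_upwards [ae_summable ρ hρ t, h2] with w hw hwS
  exact hS.mem_of_tendsto hw.of_norm.hasSum.tendsto_sum_nat
    (Eventually.of_forall fun N => S.sum_mem fun n _ => hwS n)

end Moments

end LevySemigroup

/-! ### Nondegeneracy of the curve at small scales -/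

lemma IsJumpCurve.taylor {d : ℕ} {γ : ℝ → EuclideanSpace ℝ (Fin d)} (hγ : IsJumpCurve γ) (k : ℕ) :
    ∃ B : ℝ, 0 ≤ B ∧ ∀ w ∈ Set.Icc (0 : ℝ) 1,
      ‖deriv γ w - ∑ j ∈ Finset.range (k + 1), ((j.factorial : ℝ)⁻¹ * w ^ j) •
        iteratedDeriv (j + 1) γ 0‖ ≤ B * w ^ (k + 1) := by
  obtain ⟨B, hB⟩ := hγ.bounded (k + 2) (by omega)
  have hB0 : 0 ≤ B := (norm_nonneg _).trans (hB 0)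
  have hd : ContDiff ℝ ∞ (deriv γ) := ((contDiff_infty_iff_deriv (𝕜 := ℝ)).1 hγ.smooth).2
  have hu : UniqueDiffOn ℝ (Set.Icc (0 : ℝ) 1) := uniqueDiffOn_Icc one_pos
  have hit : ∀ (j : ℕ) (y : ℝ), y ∈ Set.Icc (0 : ℝ) 1 →
      iteratedDerivWithin j (deriv γ) (Set.Icc 0 1) y = iteratedDeriv (j + 1) γ y := by
    intro j y hy
    rw [iteratedDerivWithin_eq_iteratedDeriv hu (hd.of_le (by exact_mod_cast le_top)).contDiffAt hy,
      iteratedDeriv_succ']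
  refine ⟨B / k.factorial, by positivity, fun w hw => ?_⟩
  have h := taylor_mean_remainder_bound (f := deriv γ) (a := 0) (b := 1) (C := B) (n := k)
    zero_le_one (hd.of_le (by exact_mod_cast le_top)).contDiffOn hw
    (fun y hy => by rw [hit _ y hy]; exact hB y)
  rw [taylor_within_apply] at h
  simp only [sub_zero, hit _ 0 (by simp : (0 : ℝ) ∈ Set.Icc (0 : ℝ) 1)] at h
  rwa [div_mul_eq_mul_div]

/-- The mean over `[1/2, 1]` of `1 - exp (-q² / 2)` is bounded below over all polynomials `q` of
degree at most `k` whose largest coefficient has absolute value one. -/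
lemma exists_lower_bound_polynomial (k : ℕ) : ∃ m : ℝ, 0 < m ∧ ∀ b : Fin (k + 1) → ℝ, ‖b‖ = 1 →
    m ≤ ∫ s in (1 / 2 : ℝ)..1, (1 - Real.exp (-(∑ j, b j * s ^ (j : ℕ)) ^ 2 / 2)) := by
  set F : (Fin (k + 1) → ℝ) → ℝ := fun b =>
    ∫ s in (1 / 2 : ℝ)..1, (1 - Real.exp (-(∑ j, b j * s ^ (j : ℕ)) ^ 2 / 2)) with hF
  have hFc : Continuous F :=
    intervalIntegral.continuous_parametric_intervalIntegral_of_continuous' (by fun_prop) _ _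
  have hpos : ∀ b : Fin (k + 1) → ℝ, ‖b‖ = 1 → 0 < F b := by
    intro b hb
    have hc : Continuous fun s : ℝ => 1 - Real.exp (-(∑ j, b j * s ^ (j : ℕ)) ^ 2 / 2) := by fun_prop
    set q : Polynomial ℝ := ∑ j : Fin (k + 1), Polynomial.monomial (j : ℕ) (b j) with hq
    have hqe : ∀ s, q.eval s = ∑ j, b j * s ^ (j : ℕ) := fun s => by
      simp [hq, Polynomial.eval_finsetSum]
    have hq0 : q ≠ 0 := by
      intro h0
      have : b = 0 := by
        ext i
        have := congrArg (fun p => Polynomial.coeff p (i : ℕ)) h0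
        simpa [hq, Polynomial.finsetSum_coeff, Polynomial.coeff_monomial, Fin.val_inj] using this
      rw [this, norm_zero] at hb
      exact zero_ne_one hb
    obtain ⟨s, hs, hsr⟩ : ∃ s ∈ Set.Ioo (1 / 2 : ℝ) 1, s ∉ q.rootSet ℝ :=
      ((Set.Ioo_infinite (by norm_num)).sdiff (q.rootSet_finite ℝ)).nonempty
    have hqs : q.eval s ≠ 0 := fun h0 => hsr (by
      rw [Polynomial.mem_rootSet]; exact ⟨hq0, by simpa using h0⟩)
    refine intervalIntegral.integral_pos (by norm_num) hc.continuousOn (fun x _ => ?_)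
      ⟨s, Set.Ioo_subset_Icc_self hs, ?_⟩
    · rw [sub_nonneg, Real.exp_le_one_iff]
      have := sq_nonneg (∑ j, b j * x ^ (j : ℕ))
      linarith
    · rw [sub_pos, Real.exp_lt_one_iff, ← hqe]
      have : 0 < q.eval s ^ 2 := by positivity
      linarith
  obtain ⟨b₀, hb₀, hmin⟩ := (isCompact_sphere (0 : Fin (k + 1) → ℝ) 1).exists_isMinOn
    (NormedSpace.sphere_nonempty.2 zero_le_one) hFc.continuousOn
  exact ⟨F b₀, hpos b₀ (by simpa using hb₀), fun b hb => hmin (by simpa using hb)⟩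

/-- The linear map that sends `ξ` to the Taylor coefficients at `0` of `w ↦ ⟪ξ, γ'(w)⟫`. -/
noncomputable def taylorCoeff {d : ℕ} (γ : ℝ → EuclideanSpace ℝ (Fin d)) (k : ℕ) :
    EuclideanSpace ℝ (Fin d) →ₗ[ℝ] (Fin (k + 1) → ℝ) :=
  LinearMap.pi fun j => (((j : ℕ).factorial : ℝ)⁻¹) •
    (innerₛₗ ℝ (iteratedDeriv ((j : ℕ) + 1) γ 0) : EuclideanSpace ℝ (Fin d) →ₗ[ℝ] ℝ)

lemma taylorCoeff_apply {d : ℕ} (γ : ℝ → EuclideanSpace ℝ (Fin d)) (k : ℕ)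
    (ξ : EuclideanSpace ℝ (Fin d)) (j : Fin (k + 1)) :
    taylorCoeff γ k ξ j = ((j : ℕ).factorial : ℝ)⁻¹ * ⟪ξ, iteratedDeriv ((j : ℕ) + 1) γ 0⟫ := by
  simp [taylorCoeff, real_inner_comm]

lemma exists_norm_le_taylorCoeff {d : ℕ} {γ : ℝ → EuclideanSpace ℝ (Fin d)} (hγ : IsJumpCurve γ)
    (hH : SpanCondition γ) :
    ∃ k : ℕ, ∃ c : ℝ, 0 < c ∧ ∀ ξ, c * ‖ξ‖ ≤ ‖taylorCoeff γ k ξ‖ := by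
  obtain ⟨k, hk⟩ := hH
  refine ⟨k, ?_⟩
  have hker : LinearMap.ker (taylorCoeff γ k) = ⊥ := by
    rw [LinearMap.ker_eq_bot']
    intro ξ hξ
    have h1 : Submodule.span ℝ {v | ∃ l ≤ k, v = iteratedDeriv l γ 0} ≤
        LinearMap.ker (innerₛₗ ℝ ξ : EuclideanSpace ℝ (Fin d) →ₗ[ℝ] ℝ) := by
      rw [Submodule.span_le]
      rintro v ⟨l, hl, rfl⟩
      rcases l with _ | j
      · simp [hγ.zero]
      · have := congrFun hξ ⟨j, by omega⟩
        rw [taylorCoeff_apply] at this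
        simpa [Nat.factorial_ne_zero] using this
    rw [hk] at h1
    have h2 : ξ ∈ LinearMap.ker (innerₛₗ ℝ ξ : EuclideanSpace ℝ (Fin d) →ₗ[ℝ] ℝ) := h1 trivial
    simpa using h2
  obtain ⟨K, hK, hanti⟩ := LinearMap.exists_antilipschitzWith _ hker
  refine ⟨(K : ℝ)⁻¹, by positivity, fun ξ => ?_⟩
  have := hanti.le_mul_dist ξ 0
  simp only [dist_zero_right, map_zero] at this
  rwa [inv_mul_le_iff₀ (by exact_mod_cast hK)]

/-- Quantitative Hörmander condition: at scale `η`, once `‖ξ‖ η^(k + 2)` is large, the function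
`w ↦ w⁴ ⟪ξ, γ'(w)⟫²` is bounded below in the mean over `[η / 2, η]`. -/
lemma exists_nondegenerate {d : ℕ} {γ : ℝ → EuclideanSpace ℝ (Fin d)} (hγ : IsJumpCurve γ)
    (hH : SpanCondition γ) : ∃ k : ℕ, ∃ η₀ m M : ℝ, 0 < η₀ ∧ 0 < m ∧ 0 < M ∧
      ∀ (ξ : EuclideanSpace ℝ (Fin d)) (η : ℝ), 0 < η → η ≤ η₀ → M ≤ ‖ξ‖ * η ^ (k + 2) →
        m ≤ ∫ s in (1 / 2 : ℝ)..1, (1 - Real.exp (-((η * s) ^ 4 * ⟪ξ, deriv γ (η * s)⟫ ^ 2))) := by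
  obtain ⟨k, c, hc, hcξ⟩ := exists_norm_le_taylorCoeff hγ hH
  obtain ⟨m, hm, hmb⟩ := exists_lower_bound_polynomial k
  obtain ⟨B, hB0, hB⟩ := hγ.taylor k
  -- the relative size of the Taylor remainder at scale `η` is at most `B / c * η`
  have hlim : Tendsto (fun η : ℝ => Real.exp ((B / c * η) ^ 2) - 1) (𝓝 0) (𝓝 0) := by
    have : Continuous fun η : ℝ => Real.exp ((B / c * η) ^ 2) - 1 := by fun_prop
    simpa using this.tendsto 0
  obtain ⟨δ, hδ, hδm⟩ := Metric.eventually_nhds_iff.1 (hlim.eventually (gt_mem_nhds (half_pos hm)))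
  refine ⟨k, min (δ / 2) 1, m / 2, 4 / c, by positivity, by positivity, by positivity, ?_⟩
  intro ξ η hη hη0 hM
  have hη1 : η ≤ 1 := hη0.trans (min_le_right _ _)
  have hηδ : Real.exp ((B / c * η) ^ 2) - 1 < m / 2 := hδm (by
    rw [Real.dist_eq, sub_zero, abs_of_pos hη]
    linarith [hη0.trans (min_le_left _ _)])
  have hξ : 0 < ‖ξ‖ := by
    by_contra h0
    have : ‖ξ‖ = 0 := le_antisymm (not_lt.1 h0) (norm_nonneg _)
    rw [this, zero_mul] at hM
    have : 0 < 4 / c := by positivity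
    linarith
  set b : Fin (k + 1) → ℝ := fun j => taylorCoeff γ k ξ j * η ^ (j : ℕ) with hb
  set N := ‖b‖ with hN
  have hNc : c * ‖ξ‖ * η ^ k ≤ N := by
    refine (mul_le_mul_of_nonneg_right (hcξ ξ) (by positivity)).trans ?_
    rw [← le_div_iff₀ (by positivity), pi_norm_le_iff_of_nonneg (by positivity)]
    intro j
    rw [le_div_iff₀ (by positivity)]
    refine le_trans ?_ (norm_le_pi_norm b j)
    simp only [hb]
    rw [norm_mul, norm_pow, Real.norm_of_nonneg hη.le]
    exact mul_le_mul_of_nonneg_left (pow_le_pow_of_le_one hη.le hη1 (by omega)) (norm_nonneg _)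
  have hN0 : 0 < N := lt_of_lt_of_le (by positivity) hNc
  set q : ℝ → ℝ := fun s => ∑ j, (N⁻¹ * b j) * s ^ (j : ℕ) with hq
  have hqm := hmb (fun j => N⁻¹ * b j) (by
    change ‖N⁻¹ • b‖ = 1
    rw [norm_smul, norm_inv, Real.norm_of_nonneg hN0.le, inv_mul_cancel₀ hN0.ne'])
  have hcd : Continuous (deriv γ) := hγ.smooth.continuous_deriv (by simp)
  have hP : 1 ≤ (η ^ 2 * N / 4) ^ 2 := by
    refine one_le_pow₀ ?_
    rw [div_le_iff₀ hc] at hM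
    have : η ^ 2 * (c * ‖ξ‖ * η ^ k) ≤ η ^ 2 * N := by gcongr
    rw [le_div_iff₀ (by norm_num)]
    calc 1 * 4 ≤ ‖ξ‖ * η ^ (k + 2) * c := by linarith
      _ = η ^ 2 * (c * ‖ξ‖ * η ^ k) := by ring
      _ ≤ _ := this
  have hpt : ∀ s ∈ Set.Icc (1 / 2 : ℝ) 1,
      (1 - Real.exp (-(q s) ^ 2 / 2)) - (Real.exp ((B / c * η) ^ 2) - 1) ≤
        1 - Real.exp (-((η * s) ^ 4 * ⟪ξ, deriv γ (η * s)⟫ ^ 2)) := by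
    intro s hs
    have hs0 : 0 < s := by linarith [hs.1]
    have hηs : η * s ∈ Set.Icc (0 : ℝ) 1 := ⟨by positivity, by nlinarith [hs.2]⟩
    set D := ⟪ξ, deriv γ (η * s)⟫ with hD
    -- comparison with the Taylor polynomial
    have hrem : |D - N * q s| ≤ ‖ξ‖ * (B * η ^ (k + 1)) := by
      have e : N * q s = ⟪ξ, ∑ j ∈ Finset.range (k + 1), ((j.factorial : ℝ)⁻¹ * (η * s) ^ j) •
          iteratedDeriv (j + 1) γ 0⟫ := by
        rw [inner_sum, Finset.sum_range, hq, Finset.mul_sum]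
        refine Finset.sum_congr rfl fun j _ => ?_
        rw [inner_smul_right, hb]
        simp only [taylorCoeff_apply]
        rw [mul_pow]
        field_simp
      rw [hD, e, ← inner_sub_right]
      refine (abs_real_inner_le_norm _ _).trans ?_
      gcongr
      refine (hB _ hηs).trans ?_
      gcongr
      nlinarith [hs.2]
    have hrel : |D / N - q s| ≤ B / c * η := by
      have : D / N - q s = (D - N * q s) / N := by field_simp
      rw [this, abs_div, abs_of_pos hN0, div_le_iff₀ hN0]
      refine hrem.trans ?_
      calc ‖ξ‖ * (B * η ^ (k + 1)) = B / c * η * (c * ‖ξ‖ * η ^ k) := by field_simp; ring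
        _ ≤ _ := by gcongr
    have hsq : (q s) ^ 2 / 2 - (B / c * η) ^ 2 ≤ (D / N) ^ 2 := by
      have h1 : (D / N - q s) ^ 2 ≤ (B / c * η) ^ 2 := by
        rw [← sq_abs]; gcongr
      nlinarith [sq_nonneg (2 * (D / N) - q s)]
    have hX : (q s) ^ 2 / 2 - (B / c * η) ^ 2 ≤ (η * s) ^ 4 * D ^ 2 := by
      refine hsq.trans ?_
      have h2 : (η ^ 2 * N / 4) ^ 2 * (D / N) ^ 2 ≤ (η * s) ^ 4 * D ^ 2 := by
        have : (η ^ 2 * N / 4) ^ 2 * (D / N) ^ 2 = (η * (1 / 2)) ^ 4 * D ^ 2 := by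
          field_simp; ring
        rw [this]
        have := hs.1
        gcongr
      refine le_trans ?_ h2
      exact le_mul_of_one_le_left (sq_nonneg _) hP
    have h3 : Real.exp (-((η * s) ^ 4 * D ^ 2)) ≤
        Real.exp (-(q s) ^ 2 / 2) * Real.exp ((B / c * η) ^ 2) := by
      rw [← Real.exp_add, Real.exp_le_exp]
      linarith
    have h4 : Real.exp (-(q s) ^ 2 / 2) ≤ 1 := by
      rw [Real.exp_le_one_iff]
      linarith [sq_nonneg (q s)]
    have h5 : 1 ≤ Real.exp ((B / c * η) ^ 2) := Real.one_le_exp (sq_nonneg _)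
    nlinarith
  have hint := intervalIntegral.integral_mono_on (a := (1 / 2 : ℝ)) (b := 1) (μ := volume)
    (by norm_num) (Continuous.intervalIntegrable (by fun_prop) _ _)
    (Continuous.intervalIntegrable (by fun_prop) _ _) hpt
  rw [intervalIntegral.integral_sub (Continuous.intervalIntegrable (by fun_prop) _ _)
    (by simp), intervalIntegral.integral_const] at hint
  refine le_trans ?_ hint
  have : (1 - 1 / 2 : ℝ) • (Real.exp ((B / c * η) ^ 2) - 1) ≤ m / 4 := by
    rw [smul_eq_mul]; linarith
  linarith

/-! ### Negative powers of a positive matrix as Gaussian-type integrals -/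

/-- The linear functional `V ↦ ⟪ξ, V ξ⟫`. -/
noncomputable def quadForm {d : ℕ} (ξ : EuclideanSpace ℝ (Fin d)) : StrongDual ℝ (SymMatrix d) :=
  (innerSL ℝ ξ) ∘L (ContinuousLinearMap.apply ℝ (EuclideanSpace ℝ (Fin d)) ξ) ∘L
    SymMatrix.toCLM.toContinuousLinearMap

lemma quadForm_apply {d : ℕ} (ξ : EuclideanSpace ℝ (Fin d)) (V : SymMatrix d) :
    quadForm ξ V = ⟪ξ, V.toCLM ξ⟫ := rfl

/-- The trace, as a continuous linear functional. -/
noncomputable def traceForm (d : ℕ) : StrongDual ℝ (SymMatrix d) :=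
  ∑ i : Fin d, quadForm (EuclideanSpace.basisFun (Fin d) ℝ i)

lemma quadForm_sqForm {d : ℕ} (ξ v : EuclideanSpace ℝ (Fin d)) :
    quadForm ξ (sqForm v) = ⟪ξ, v⟫ ^ 2 := by
  have h : (sqForm v).toCLM = InnerProductSpace.rankOne ℝ v v := rfl
  rw [quadForm_apply, h, InnerProductSpace.rankOne_apply, inner_smul_right, real_inner_comm, sq]

lemma traceForm_sqForm {d : ℕ} (v : EuclideanSpace ℝ (Fin d)) :
    traceForm d (sqForm v) = ‖v‖ ^ 2 := by
  simp only [traceForm, sum_apply, quadForm_sqForm]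
  simpa using (EuclideanSpace.basisFun (Fin d) ℝ).sum_sq_norm_inner_right v

lemma continuous_quadForm {d : ℕ} :
    Continuous fun z : MalliavinSpace d × EuclideanSpace ℝ (Fin d) => quadForm z.2 z.1.2 := by
  simp only [quadForm_apply]
  exact continuous_snd.inner
    ((SymMatrix.toCLM.continuous.comp (continuous_snd.comp continuous_fst)).clm_apply
      continuous_snd)

/-- The quadratic form of a matrix satisfies the parallelogram law. -/
lemma quadForm_parallelogram {d : ℕ} (ξ η : EuclideanSpace ℝ (Fin d)) (V : SymMatrix d) :
    quadForm (ξ + η) V + quadForm (ξ - η) V = 2 * quadForm ξ V + 2 * quadForm η V := by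
  simp only [quadForm_apply, map_add, map_sub, inner_add_left, inner_add_right, inner_sub_left,
    inner_sub_right]
  ring

lemma quadForm_smul {d : ℕ} (c : ℝ) (ξ : EuclideanSpace ℝ (Fin d)) (V : SymMatrix d) :
    quadForm (c • ξ) V = c ^ 2 * quadForm ξ V := by
  simp only [quadForm_apply, map_smul, inner_smul_left, inner_smul_right]
  simp; ring

/-- The pairs `(x, V)` with `0 ≤ ⟪ξ, V ξ⟫ ≤ ‖ξ‖² tr V` for all `ξ`. The second inequality follows
from the first one, but as both are closed under sums and limits it costs nothing to carry it. -/
def positiveCone (d : ℕ) : AddSubmonoid (MalliavinSpace d) where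
  carrier := {y | ∀ ξ, 0 ≤ quadForm ξ y.2 ∧ quadForm ξ y.2 ≤ ‖ξ‖ ^ 2 * traceForm d y.2}
  zero_mem' := fun ξ => by simp
  add_mem' := fun {a b} ha hb ξ => by
    have h1 := ha ξ
    have h2 := hb ξ
    simp only [Prod.snd_add, map_add, mul_add]
    exact ⟨add_nonneg h1.1 h2.1, add_le_add h1.2 h2.2⟩

lemma mem_positiveCone {d : ℕ} {y : MalliavinSpace d} : y ∈ positiveCone d ↔
    ∀ ξ, 0 ≤ quadForm ξ y.2 ∧ quadForm ξ y.2 ≤ ‖ξ‖ ^ 2 * traceForm d y.2 := Iff.rfl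

lemma isClosed_positiveCone (d : ℕ) : IsClosed (positiveCone d : Set (MalliavinSpace d)) := by
  change IsClosed {y : MalliavinSpace d |
    ∀ ξ, 0 ≤ quadForm ξ y.2 ∧ quadForm ξ y.2 ≤ ‖ξ‖ ^ 2 * traceForm d y.2}
  simp only [Set.ofPred_forall, Set.ofPred_and]
  exact isClosed_iInter fun ξ => (isClosed_le (by fun_prop) (by fun_prop)).inter
    (isClosed_le (by fun_prop) (by fun_prop))

lemma malliavinJump_mem_positiveCone {d : ℕ} (γ : ℝ → EuclideanSpace ℝ (Fin d)) {ν : ℝ → ℝ}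
    (hν : IsJumpWeight ν) (w : ℝ) : malliavinJump γ ν w ∈ positiveCone d := by
  rw [mem_positiveCone]
  intro ξ
  simp only [malliavinJump, map_smul, quadForm_sqForm, traceForm_sqForm, smul_eq_mul]
  have h := hν.nonneg w
  refine ⟨by positivity, ?_⟩
  have h2 : ⟪ξ, deriv γ w⟫ ^ 2 ≤ ‖ξ‖ ^ 2 * ‖deriv γ w‖ ^ 2 := by
    rw [← mul_pow, ← sq_abs]
    gcongr
    exact abs_real_inner_le_norm _ _
  nlinarith

lemma isUnit_of_coercive {F : Type*} [NormedAddCommGroup F] [InnerProductSpace ℝ F]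
    [FiniteDimensional ℝ F] {f : F →L[ℝ] F} {ε : ℝ} (hε : 0 < ε)
    (hf : ∀ ξ, ε * ‖ξ‖ ^ 2 ≤ ⟪ξ, f ξ⟫) : IsUnit f ∧ ‖Ring.inverse f‖ ≤ ε⁻¹ := by
  have hb : ∀ ξ, ε * ‖ξ‖ ≤ ‖f ξ‖ := by
    intro ξ
    rcases eq_or_ne ξ 0 with rfl | h
    · simp
    · have h1 := (hf ξ).trans (real_inner_le_norm _ _)
      have h2 : 0 < ‖ξ‖ := norm_pos_iff.2 h
      refine le_of_mul_le_mul_left ?_ h2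
      linarith [sq ‖ξ‖]
  have hinj : Function.Injective f := by
    rw [injective_iff_map_eq_zero]
    intro ξ h0
    have := hb ξ
    rw [h0, norm_zero] at this
    exact norm_le_zero_iff.1 (by nlinarith [norm_nonneg ξ])
  have hcomplete : CompleteSpace F := FiniteDimensional.complete ℝ F
  have hu : IsUnit f := by
    rw [ContinuousLinearMap.isUnit_iff_bijective]
    exact ⟨hinj, (LinearMap.injective_iff_surjective (f := (f : F →ₗ[ℝ] F))).1 hinj⟩
  refine ⟨hu, ContinuousLinearMap.opNorm_le_bound _ (by positivity) fun y => ?_⟩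
  have h1 := hb (Ring.inverse f y)
  have h2 : f (Ring.inverse f y) = y :=
    congrArg (fun T : F →L[ℝ] F => T y) (Ring.mul_inverse_cancel f hu)
  rw [h2] at h1
  rwa [inv_mul_eq_div, le_div_iff₀ hε, mul_comm]

/-- The negative power `V^{-p}` is dominated by a Gaussian-type integral, whose integrand is the
exponential of a linear functional of `V`: if `⟪e, V e⟫ < R⁻²` for a unit vector `e`, then
`⟪ξ, V ξ⟫ ≤ 2 + 2 tr V` on the unit ball around `R e`, so that the integral is at least of the
order of `R ^ (2 p)`. -/
lemma invNormPow_le {d : ℕ} {p : ℝ} (hp : 0 < p) {y : MalliavinSpace d} (hy : y ∈ positiveCone d) :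
    invNormPow p y.2 ≤ ENNReal.ofReal (4 ^ p) + ENNReal.ofReal (4 ^ p * Real.exp 2 /
      (volume : Measure (EuclideanSpace ℝ (Fin d))).real (Metric.ball 0 1)) *
        ∫⁻ ξ : EuclideanSpace ℝ (Fin d),
          ENNReal.ofReal (‖ξ‖ ^ (2 * p) * Real.exp (2 * traceForm d y.2 - quadForm ξ y.2)) := by
  set V := y.2
  set v := (volume : Measure (EuclideanSpace ℝ (Fin d))).real (Metric.ball 0 1) with hv
  have hv0 : 0 < v := ENNReal.toReal_pos (Metric.measure_ball_pos volume _ one_pos).ne'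
    measure_ball_lt_top.ne
  set K := 4 ^ p * Real.exp 2 / v with hK
  have hK0 : 0 < K := by positivity
  set I := ∫⁻ ξ : EuclideanSpace ℝ (Fin d),
    ENNReal.ofReal (‖ξ‖ ^ (2 * p) * Real.exp (2 * traceForm d V - quadForm ξ V)) with hI
  rcases eq_or_ne I ⊤ with htop | htop
  · rw [htop, ENNReal.mul_top (by simpa using hK0)]
    simp
  set i := I.toReal with hi
  have hi0 : 0 ≤ i := ENNReal.toReal_nonneg
  have hIi : I = ENNReal.ofReal i := (ENNReal.ofReal_toReal htop).symm
  set T := 4 ^ p + K * i with hT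
  have hT4 : (4 : ℝ) ^ p ≤ T := by rw [hT]; have := mul_nonneg hK0.le hi0; linarith
  have hT0 : 0 < T := lt_of_lt_of_le (by positivity) hT4
  set S := T ^ p⁻¹ with hS
  have hS0 : 0 < S := by positivity
  have hSp : S ^ p = T := by rw [hS, ← Real.rpow_mul hT0.le, inv_mul_cancel₀ hp.ne', Real.rpow_one]
  have hS4 : 4 ≤ S := by
    rw [← Real.rpow_le_rpow_iff (by norm_num) hS0.le hp, hSp]; exact hT4
  have hcoer : ∀ ξ, S⁻¹ * ‖ξ‖ ^ 2 ≤ ⟪ξ, V.toCLM ξ⟫ := by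
    intro ξ
    rw [← quadForm_apply]
    by_contra! hlt
    have hξ : 0 < ‖ξ‖ := by
      by_contra h0
      have h0' : ‖ξ‖ = 0 := le_antisymm (not_lt.1 h0) (norm_nonneg _)
      rw [h0'] at hlt
      have := (hy ξ).1
      simp only [ne_eq, OfNat.ofNat_ne_zero, not_false_eq_true, zero_pow, mul_zero] at hlt
      exact absurd this (not_le.2 hlt)
    -- `R` is such that the lower bound for the integral on the ball around `R e` exceeds `I`
    set R := Real.sqrt S with hR
    have hR2 : R ^ 2 = S := Real.sq_sqrt hS0.le
    have hR4 : 2 ≤ R := Real.le_sqrt_of_sq_le (by linarith)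
    set e := (R * ‖ξ‖⁻¹) • ξ with he
    have hen : ‖e‖ = R := by
      rw [he, norm_smul, norm_mul, norm_inv, norm_norm, Real.norm_of_nonneg (by linarith)]
      field_simp
    have hQe : quadForm e V ≤ 1 := by
      rw [he, quadForm_smul, mul_pow, hR2]
      have : S * ‖ξ‖⁻¹ ^ 2 * (S⁻¹ * ‖ξ‖ ^ 2) = 1 := by field_simp
      rw [← this]
      gcongr
    have hlow : ∀ ζ ∈ Metric.ball e 1, ENNReal.ofReal ((R / 2) ^ (2 * p) * Real.exp (-2)) ≤
        ENNReal.ofReal (‖ζ‖ ^ (2 * p) * Real.exp (2 * traceForm d V - quadForm ζ V)) := by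
      intro ζ hζ
      have h1 : ‖ζ - e‖ ≤ 1 := by rw [← dist_eq_norm]; exact (Metric.mem_ball.1 hζ).le
      have h2 : R / 2 ≤ ‖ζ‖ := by
        have := norm_sub_norm_le e ζ
        rw [norm_sub_rev, hen] at this
        linarith
      have htr : 0 ≤ traceForm d V := by
        have hone := hy (‖ξ‖⁻¹ • ξ)
        rw [norm_smul, norm_inv, norm_norm, inv_mul_cancel₀ hξ.ne', one_pow, one_mul] at hone
        exact hone.1.trans hone.2
      have h3 : quadForm ζ V ≤ 2 + 2 * traceForm d V := by
        have hpar := quadForm_parallelogram e (ζ - e) V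
        rw [add_sub_cancel] at hpar
        have h4 := (hy (e - (ζ - e))).1
        have h5 := (hy (ζ - e)).2
        have h6 : ‖ζ - e‖ ^ 2 * traceForm d V ≤ 1 * traceForm d V := by
          gcongr
          exact pow_le_one₀ (norm_nonneg _) h1
        change 0 ≤ quadForm (e - (ζ - e)) V at h4
        change quadForm (ζ - e) V ≤ ‖ζ - e‖ ^ 2 * traceForm d V at h5
        linarith
      refine ENNReal.ofReal_le_ofReal ?_
      gcongr
      linarith
    have hRp : (R / 2) ^ (2 * p) = T / 4 ^ p := by
      rw [Real.rpow_mul (by positivity), ← hSp, ← Real.div_rpow hS0.le (by norm_num)]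
      congr 1
      rw [Real.rpow_two, div_pow, hR2]
      norm_num
    have hbig : ENNReal.ofReal (T / 4 ^ p * Real.exp (-2) * v) ≤ I := by
      calc ENNReal.ofReal (T / 4 ^ p * Real.exp (-2) * v)
          = ∫⁻ ζ in Metric.ball e 1, ENNReal.ofReal ((R / 2) ^ (2 * p) * Real.exp (-2)) := by
            rw [setLIntegral_const, hRp, ENNReal.ofReal_mul (by positivity), hv,
              Measure.addHaar_ball_center volume e, Measure.real, ENNReal.ofReal_toReal
                measure_ball_lt_top.ne]
        _ ≤ ∫⁻ ζ in Metric.ball e 1,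
            ENNReal.ofReal (‖ζ‖ ^ (2 * p) * Real.exp (2 * traceForm d V - quadForm ζ V)) :=
          setLIntegral_mono' measurableSet_ball hlow
        _ ≤ I := setLIntegral_le_lintegral _ _
    rw [hIi, ENNReal.ofReal_le_ofReal_iff hi0] at hbig
    have e1 : K * (T / 4 ^ p * Real.exp (-2) * v) = T := by
      rw [hK, Real.exp_neg]; field_simp
    have := mul_le_mul_of_nonneg_left hbig hK0.le
    rw [e1, hT] at this
    have : (0 : ℝ) < 4 ^ p := by positivity
    linarith
  obtain ⟨hu, hn⟩ := isUnit_of_coercive (inv_pos.2 hS0) hcoer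
  rw [invNormPow, if_pos hu, hIi, ← ENNReal.ofReal_mul hK0.le,
    ← ENNReal.ofReal_add (by positivity) (by positivity), ← hT, ← hSp]
  rw [inv_inv] at hn
  exact ENNReal.ofReal_le_ofReal (Real.rpow_le_rpow (norm_nonneg _) hn hp.le)

/-! ### The jump measure of the enlarged process -/

/-- The jump measure of the process generated by `malliavinGenerator γ ν g h`. -/
noncomputable def jumpMeasure {d : ℕ} (γ : ℝ → EuclideanSpace ℝ (Fin d)) (ν g : ℝ → ℝ) (h : ℝ) :
    Measure (MalliavinSpace d) :=
  (volume.withDensity fun z => ENNReal.ofReal (h⁻¹ * g z)).map fun z => malliavinJump γ ν (h * z)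

instance {d : ℕ} (γ : ℝ → EuclideanSpace ℝ (Fin d)) (ν g : ℝ → ℝ) (h : ℝ) :
    SFinite (jumpMeasure γ ν g h) := by
  unfold jumpMeasure; infer_instance

lemma ae_ne_zero_real : ∀ᵐ z : ℝ, z ≠ 0 := ae_iff.2 (by simp : volume {z : ℝ | ¬ z ≠ 0} = 0)

lemma abs_exp_sub_one_le_mul_exp (x : ℝ) : |Real.exp x - 1| ≤ |x| * Real.exp |x| := by
  rcases le_total 0 x with hx | hx
  · have h0 := Real.one_le_exp hx
    rw [abs_of_nonneg hx, abs_of_nonneg (by linarith)]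
    have h1 := Real.add_one_le_exp (-x)
    have h2 : Real.exp x * Real.exp (-x) = 1 := by rw [← Real.exp_add]; simp
    nlinarith [Real.exp_pos x]
  · have h0 := Real.exp_le_one_iff.2 hx
    rw [abs_of_nonpos hx, abs_of_nonpos (by linarith)]
    have h1 := Real.add_one_le_exp x
    have h2 := Real.one_le_exp (neg_nonneg.2 hx)
    nlinarith

section JumpMeasure

variable {d : ℕ} {g : ℝ → ℝ} {C α : ℝ} {γ : ℝ → EuclideanSpace ℝ (Fin d)} {ν : ℝ → ℝ} {h : ℝ}

lemma continuous_jump (hγ : IsJumpCurve γ) (hν : IsJumpWeight ν) (h : ℝ) :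
    Continuous fun z => malliavinJump γ ν (h * z) :=
  (continuous_malliavinJump hγ hν).comp (by fun_prop)

lemma integral_jumpMeasure (hg : IsJumpDensity g C α) (hγ : IsJumpCurve γ) (hν : IsJumpWeight ν)
    (hh : 0 < h) {F : MalliavinSpace d → ℝ} (hF : Continuous F) :
    ∫ y, F y ∂(jumpMeasure γ ν g h) = ∫ z, F (malliavinJump γ ν (h * z)) * (h⁻¹ * g z) := by
  have hqm : AEMeasurable fun z => ENNReal.ofReal (h⁻¹ * g z) := by
    have := hg.aemeasurable; fun_prop
  rw [jumpMeasure, integral_map (continuous_jump hγ hν h).measurable.aemeasurable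
    hF.aestronglyMeasurable,
    integral_withDensity_eq_integral_toReal_smul₀ hqm (ae_of_all _ fun z => by simp)]
  refine integral_congr_ae ?_
  filter_upwards [ae_ne_zero_real] with z hz
  have hgz := hg.nonneg z hz
  rw [ENNReal.toReal_ofReal (by positivity), smul_eq_mul, mul_comm]

lemma integrable_jumpMeasure_iff (hg : IsJumpDensity g C α) (hγ : IsJumpCurve γ)
    (hν : IsJumpWeight ν) (hh : 0 < h) {F : MalliavinSpace d → ℝ} (hF : Continuous F) :
    Integrable F (jumpMeasure γ ν g h) ↔
      Integrable fun z => F (malliavinJump γ ν (h * z)) * (h⁻¹ * g z) := by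
  have hqm : AEMeasurable fun z => ENNReal.ofReal (h⁻¹ * g z) := by
    have := hg.aemeasurable; fun_prop
  rw [jumpMeasure, integrable_map_measure hF.aestronglyMeasurable
    (continuous_jump hγ hν h).measurable.aemeasurable,
    integrable_withDensity_iff_integrable_smul₀' hqm (ae_of_all _ fun z => by simp)]
  refine integrable_congr ?_
  filter_upwards [ae_ne_zero_real] with z hz
  have hgz := hg.nonneg z hz
  rw [ENNReal.toReal_ofReal (by positivity), smul_eq_mul, mul_comm, Function.comp_apply]

lemma lintegral_norm_jumpMeasure (hg : IsJumpDensity g C α) (hγ : IsJumpCurve γ)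
    (hν : IsJumpWeight ν) (hh : 0 < h) : ∫⁻ y, ‖y‖ₑ ∂(jumpMeasure γ ν g h) ≠ ⊤ := by
  obtain ⟨K, hK0, hK⟩ := norm_malliavinJump_le hγ hν
  have hi : Integrable (fun y : MalliavinSpace d => ‖y‖) (jumpMeasure γ ν g h) := by
    rw [integrable_jumpMeasure_iff hg hγ hν hh continuous_norm]
    have hm := hg.aemeasurable
    have hc := continuous_jump hγ hν h
    refine (hg.integrable_abs_mul.const_mul K).mono'
      ((hc.norm.measurable.aemeasurable.mul (hm.const_mul _)).aestronglyMeasurable) ?_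
    filter_upwards [ae_ne_zero_real] with z hz
    have hgz := hg.nonneg z hz
    rw [Real.norm_of_nonneg (by positivity)]
    calc _ ≤ (K * |h * z|) * (h⁻¹ * g z) := by gcongr; exact hK _
      _ = K * (|z| * g z) := by rw [abs_mul, abs_of_pos hh]; field_simp
  have h2 := hi.2
  simp only [HasFiniteIntegral, enorm_norm] at h2
  exact h2.ne

lemma malliavinGenerator_eq (hg : IsJumpDensity g C α) (hγ : IsJumpCurve γ)
    (hν : IsJumpWeight ν) (hh : 0 < h) {f : MalliavinSpace d → ℝ} (hf : Continuous f) :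
    malliavinGenerator γ ν g h f = fun x => ∫ y, (f (x + y) - f x) ∂(jumpMeasure γ ν g h) := by
  ext x
  rw [integral_jumpMeasure hg hγ hν hh (by fun_prop), malliavinGenerator, ← integral_const_mul]
  refine integral_congr_ae (ae_of_all _ fun z => ?_)
  ring

lemma IsMarkovSemigroupGeneratedBy.eq_kernel (hg : IsJumpDensity g C α) (hγ : IsJumpCurve γ)
    (hν : IsJumpWeight ν) (hh : 0 < h) {P : ℝ≥0 → Kernel (MalliavinSpace d) (MalliavinSpace d)}
    (hP : IsMarkovSemigroupGeneratedBy (malliavinGenerator γ ν g h) P) (t : ℝ≥0)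
    (x : MalliavinSpace d) : P t x = LevySemigroup.kernel (jumpMeasure γ ν g h) t x :=
  LevySemigroup.eq_kernel_of_generated _ (lintegral_norm_jumpMeasure hg hγ hν hh)
    ⟨hP.isMarkovKernel, hP.zero, hP.add, fun f hf => by
      rw [← malliavinGenerator_eq hg hγ hν hh hf.1.continuous]; exact hP.generator f hf⟩ t x

lemma ae_mem_positiveCone_jumpMeasure (hγ : IsJumpCurve γ) (hν : IsJumpWeight ν) (g : ℝ → ℝ)
    (h : ℝ) : ∀ᵐ y ∂(jumpMeasure γ ν g h), y ∈ positiveCone d :=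
  (ae_map_iff (continuous_jump hγ hν h).measurable.aemeasurable
    (isClosed_positiveCone d).measurableSet).2
      (ae_of_all _ fun _ => malliavinJump_mem_positiveCone γ hν _)

/-- Exponential moments of the jump measure, uniformly in the scale `h`: as `0 < α < 1`, the factor
`1 / h` is compensated by the linear bound on the jumps. -/
lemma exp_sub_one_jumpMeasure (hg : IsJumpDensity g C α) (hγ : IsJumpCurve γ)
    (hν : IsJumpWeight ν) (L : StrongDual ℝ (MalliavinSpace d)) :
    ∃ A : ℝ, ∀ h : ℝ, 0 < h → h ≤ 1 →
      Integrable (fun y => Real.exp (L y) - 1) (jumpMeasure γ ν g h) ∧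
        ∫ y, (Real.exp (L y) - 1) ∂(jumpMeasure γ ν g h) ≤ A := by
  obtain ⟨K, hK0, hK⟩ := norm_malliavinJump_le hγ hν
  set D := ‖L‖ * K with hD
  have hD0 : 0 ≤ D := by positivity
  refine ⟨∫ z, (D * Real.exp D) * (|z| * g z), fun h hh hh1 => ?_⟩
  have hFc : Continuous fun y : MalliavinSpace d => Real.exp (L y) - 1 := by fun_prop
  have hbd : ∀ᵐ z : ℝ, ‖(Real.exp (L (malliavinJump γ ν (h * z))) - 1) * (h⁻¹ * g z)‖ ≤
      (D * Real.exp D) * (|z| * g z) := by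
    filter_upwards [ae_ne_zero_real] with z hz
    have hgz := hg.nonneg z hz
    -- only `|z| ≤ 1` matters, so that the exponent is bounded by `D`
    by_cases hz1 : 1 < |z|
    · rw [hg.support z hz1]; simp
    push Not at hz1
    have h1 : |L (malliavinJump γ ν (h * z))| ≤ D * (h * |z|) := by
      calc |L (malliavinJump γ ν (h * z))| ≤ ‖L‖ * ‖malliavinJump γ ν (h * z)‖ := L.le_opNorm _
        _ ≤ ‖L‖ * (K * |h * z|) := by gcongr; exact hK _
        _ = _ := by rw [abs_mul, abs_of_pos hh, hD]; ring
    have h2 : h * |z| ≤ 1 := mul_le_one₀ hh1 (abs_nonneg _) hz1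
    have h3 : |L (malliavinJump γ ν (h * z))| ≤ D :=
      h1.trans (mul_le_of_le_one_right hD0 h2)
    rw [norm_mul, Real.norm_of_nonneg (by positivity : 0 ≤ h⁻¹ * g z), Real.norm_eq_abs]
    calc _ ≤ (D * (h * |z|) * Real.exp D) * (h⁻¹ * g z) := by
          gcongr
          refine (abs_exp_sub_one_le_mul_exp _).trans ?_
          gcongr
      _ = _ := by field_simp
  have hi := hg.integrable_abs_mul.const_mul (D * Real.exp D)
  have hint : Integrable fun z =>
      (Real.exp (L (malliavinJump γ ν (h * z))) - 1) * (h⁻¹ * g z) := by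
    refine hi.mono' ?_ hbd
    have hm := hg.aemeasurable
    exact ((hFc.comp (continuous_jump hγ hν h)).measurable.aemeasurable.mul
      (hm.const_mul _)).aestronglyMeasurable
  refine ⟨(integrable_jumpMeasure_iff hg hγ hν hh hFc).2 hint, ?_⟩
  rw [integral_jumpMeasure hg hγ hν hh hFc]
  refine integral_mono_ae hint hi ?_
  filter_upwards [hbd] with z hz
  exact (le_abs_self _).trans hz

/-- The functional `V ↦ ⟪ξ, V ξ⟫` on the enlarged state space. -/
noncomputable def quadDual (ξ : EuclideanSpace ℝ (Fin d)) : StrongDual ℝ (MalliavinSpace d) :=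
  quadForm ξ ∘L ContinuousLinearMap.snd ℝ _ _

lemma quadDual_apply (ξ : EuclideanSpace ℝ (Fin d)) (y : MalliavinSpace d) :
    quadDual ξ y = quadForm ξ y.2 := rfl

/-- The Laplace exponent in the direction `ξ` grows at least like the power `α / (k + 2)` of `‖ξ‖`,
as soon as `‖ξ‖` exceeds a multiple of `h^{-(k + 2)}`: only jumps `h z` of the size
`‖ξ‖^{-1 / (k + 2)}` are used. -/
lemma exists_laplace_lower_bound (hg : IsJumpDensity g C α) (hγ : IsJumpCurve γ)
    (hH : SpanCondition γ) (hν : IsJumpWeight ν) :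
    ∃ (k : ℕ) (R c : ℝ), 1 ≤ R ∧ 0 < c ∧ ∀ h : ℝ, 0 < h → h ≤ 1 →
      ∀ ξ : EuclideanSpace ℝ (Fin d), R * (h⁻¹) ^ (k + 2) ≤ ‖ξ‖ →
        c * ‖ξ‖ ^ (α / (k + 2)) ≤
          ∫ y, (1 - Real.exp (-quadDual ξ y)) ∂(jumpMeasure γ ν g h) := by
  obtain ⟨k, η₀, m, M, hη₀, hm, hM, hnd⟩ := exists_nondegenerate hγ hH
  obtain ⟨δ₁, hδ₁, hgδ⟩ := Metric.eventually_nhds_iff.1 (eventually_nhdsWithin_iff.1 hg.near_zero)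
  obtain ⟨δ₂, hδ₂, hνδ⟩ := Metric.eventually_nhds_iff.1 hν.near_zero
  have hC := hg.const_pos
  have hα := hg.index_pos
  have hα1 := hg.index_lt_one
  set δ := min (min (δ₁ / 2) (δ₂ / 2)) η₀ with hδ
  have hδ0 : 0 < δ := by positivity
  have hδle1 : δ ≤ δ₁ / 2 := (min_le_left _ _).trans (min_le_left _ _)
  have hδle2 : δ ≤ δ₂ / 2 := (min_le_left _ _).trans (min_le_right _ _)
  refine ⟨k, max 1 (M / δ ^ (k + 2)), C * m * (M⁻¹) ^ (α / (k + 2)), le_max_left _ _,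
    by positivity, fun h hh hh1 ξ hξ => ?_⟩
  have hk2 : (0 : ℝ) < (k : ℝ) + 2 := by positivity
  have hh1' : 1 ≤ h⁻¹ := (one_le_inv₀ hh).2 hh1
  have hr : 0 < ‖ξ‖ := lt_of_lt_of_le (by positivity) hξ
  -- the smallest scale of jumps at which the nondegeneracy applies to `ξ`
  set η := (M / ‖ξ‖) ^ ((k : ℝ) + 2)⁻¹ with hη
  have hη0 : 0 < η := by positivity
  have hηpow : η ^ (k + 2) = M / ‖ξ‖ := by
    rw [hη, ← Real.rpow_natCast, ← Real.rpow_mul (by positivity)]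
    push_cast
    rw [inv_mul_cancel₀ hk2.ne', Real.rpow_one]
  have hηδ : η ≤ δ * h := by
    refine le_of_pow_le_pow_left₀ (n := k + 2) (by omega) (by positivity) ?_
    rw [hηpow, div_le_iff₀ hr, mul_pow]
    have h1 : M / δ ^ (k + 2) * (h⁻¹) ^ (k + 2) ≤ ‖ξ‖ :=
      le_trans (by gcongr; exact le_max_right _ _) hξ
    calc M = δ ^ (k + 2) * h ^ (k + 2) * (M / δ ^ (k + 2) * (h⁻¹) ^ (k + 2)) := by
          rw [inv_pow]; field_simp
      _ ≤ _ := by gcongr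
  set κ := η / h with hκ
  have hκ0 : 0 < κ := by positivity
  have hκδ : κ ≤ δ := by rw [hκ, div_le_iff₀ hh]; exact hηδ
  have hhκ : h * κ = η := by rw [hκ]; field_simp
  have hηδ' : η ≤ δ := hηδ.trans (mul_le_of_le_one_right hδ0.le hh1)
  have hmass := hnd ξ η hη0 (hηδ'.trans (min_le_right _ _))
    (by rw [hηpow]; exact le_of_eq (by field_simp))
  set G : ℝ → ℝ := fun w => 1 - Real.exp (-(w ^ 4 * ⟪ξ, deriv γ w⟫ ^ 2)) with hG
  have hcd : Continuous (deriv γ) := hγ.smooth.continuous_deriv (by simp)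
  have hGc : Continuous G := by rw [hG]; fun_prop
  have hG0 : ∀ w, 0 ≤ G w := fun w => by
    rw [hG, sub_nonneg, Real.exp_le_one_iff, neg_nonpos]; positivity
  have hscale : ∫ z in κ / 2..κ, G (h * z) = κ * ∫ s in (1 / 2 : ℝ)..1, G (η * s) := by
    have := intervalIntegral.integral_comp_mul_left (a := 1 / 2) (b := 1)
      (fun z => G (h * z)) hκ0.ne'
    simp only [← mul_assoc, hhκ, mul_one, smul_eq_mul] at this
    rw [this, ← mul_assoc, mul_inv_cancel₀ hκ0.ne', one_mul, mul_one_div]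
  obtain ⟨A, hA⟩ := exp_sub_one_jumpMeasure hg hγ hν (-quadDual ξ)
  have hexp : Integrable (fun y => Real.exp (-quadDual ξ y) - 1) (jumpMeasure γ ν g h) :=
    (hA h hh hh1).1
  have hFc : Continuous fun y : MalliavinSpace d => 1 - Real.exp (-quadDual ξ y) := by fun_prop
  have hint : Integrable fun z =>
      (1 - Real.exp (-quadDual ξ (malliavinJump γ ν (h * z)))) * (h⁻¹ * g z) := by
    rw [← integrable_jumpMeasure_iff hg hγ hν hh hFc]
    exact hexp.neg.congr (ae_of_all _ fun y => by simp)
  rw [integral_jumpMeasure hg hγ hν hh hFc]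
  have hnonneg : ∀ᵐ z : ℝ,
      0 ≤ (1 - Real.exp (-quadDual ξ (malliavinJump γ ν (h * z)))) * (h⁻¹ * g z) := by
    filter_upwards [ae_ne_zero_real] with z hz
    have hgz := hg.nonneg z hz
    refine mul_nonneg ?_ (by positivity)
    rw [sub_nonneg, Real.exp_le_one_iff, neg_nonpos]
    exact (malliavinJump_mem_positiveCone γ hν (h * z) ξ).1
  have hlow : ∀ z ∈ Set.Ioc (κ / 2) κ, h⁻¹ * (C / κ ^ (1 + α)) * G (h * z) ≤
      (1 - Real.exp (-quadDual ξ (malliavinJump γ ν (h * z)))) * (h⁻¹ * g z) := by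
    intro z hz
    have hz0 : 0 < z := by linarith [hz.1]
    have e1 : g z = C / z ^ (1 + α) := by
      have := hgδ (y := z) (by rw [Real.dist_eq, sub_zero, abs_of_pos hz0]; linarith [hz.2])
        (by simpa using hz0.ne')
      rwa [abs_of_pos hz0] at this
    have e2 : ν (h * z) = (h * z) ^ 4 := hνδ (by
      rw [Real.dist_eq, sub_zero, abs_of_pos (by positivity)]
      have : h * z ≤ 1 * z := by gcongr
      linarith [hz.2])
    have e3 : quadDual ξ (malliavinJump γ ν (h * z)) =
        (h * z) ^ 4 * ⟪ξ, deriv γ (h * z)⟫ ^ 2 := by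
      rw [quadDual_apply, malliavinJump, map_smul, quadForm_sqForm, e2, smul_eq_mul]
    rw [e1, e3]
    change _ ≤ G (h * z) * _
    rw [mul_comm]
    have := hG0 (h * z)
    gcongr
    exact hz.2
  calc C * m * (M⁻¹) ^ (α / (k + 2)) * ‖ξ‖ ^ (α / (k + 2))
      = 1 * (C * m * η ^ (-α)) := by
        have : η ^ (-α) = (M⁻¹) ^ (α / (k + 2)) * ‖ξ‖ ^ (α / (k + 2)) := by
          rw [← Real.mul_rpow (by positivity) hr.le, hη, ← Real.rpow_mul (by positivity),
            show ((k : ℝ) + 2)⁻¹ * -α = -(α / (k + 2)) by field_simp,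
            Real.rpow_neg (by positivity), ← Real.inv_rpow (by positivity), inv_div,
            div_eq_inv_mul]
        rw [this]; ring
    _ ≤ (h⁻¹ * h ^ α) * (C * m * η ^ (-α)) := by
        gcongr
        rw [inv_mul_eq_div, one_le_div hh]
        exact Real.self_le_rpow_of_le_one hh.le hh1 hα1.le
    _ = h⁻¹ * (C / κ ^ (1 + α)) * (κ * m) := by
        rw [Real.rpow_add hκ0, Real.rpow_one, hκ, Real.div_rpow hη0.le hh.le, Real.rpow_neg hη0.le]
        field_simp
    _ ≤ h⁻¹ * (C / κ ^ (1 + α)) * (κ * ∫ s in (1 / 2 : ℝ)..1, G (η * s)) := by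
        gcongr
    _ = ∫ z in Set.Ioc (κ / 2) κ, h⁻¹ * (C / κ ^ (1 + α)) * G (h * z) := by
        rw [← hscale, ← intervalIntegral.integral_of_le (by linarith),
          intervalIntegral.integral_const_mul]
    _ ≤ ∫ z in Set.Ioc (κ / 2) κ,
        (1 - Real.exp (-quadDual ξ (malliavinJump γ ν (h * z)))) * (h⁻¹ * g z) := by
        refine setIntegral_mono_on ?_ hint.integrableOn measurableSet_Ioc hlow
        exact (Continuous.integrableOn_Icc (by fun_prop)).mono_set Set.Ioc_subset_Icc_self
    _ ≤ _ := setIntegral_le_integral hint hnonneg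

end JumpMeasure

/-! ### Integration over the directions -/

/-- The trace of the matrix component, on the enlarged state space. -/
noncomputable def traceDual (d : ℕ) : StrongDual ℝ (MalliavinSpace d) :=
  traceForm d ∘L ContinuousLinearMap.snd ℝ _ _

/-- The exponent of `exp (2 tr V - ⟪ξ, V ξ⟫)`: the trace contributes at most a constant, and the
quadratic form at least its Laplace exponent, because `e^(a - b) - 1 ≤ (e^a - 1) - (1 - e^(-b))` for
`a, b ≥ 0`. -/
lemma exists_exponent_bound {d : ℕ} {g : ℝ → ℝ} {C α : ℝ} (hg : IsJumpDensity g C α)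
    {γ : ℝ → EuclideanSpace ℝ (Fin d)} (hγ : IsJumpCurve γ) (hH : SpanCondition γ) {ν : ℝ → ℝ}
    (hν : IsJumpWeight ν) :
    ∃ (k : ℕ) (R c A : ℝ), 1 ≤ R ∧ 0 < c ∧ ∀ h : ℝ, 0 < h → h ≤ 1 →
      ∀ ξ : EuclideanSpace ℝ (Fin d),
        Integrable (fun y => Real.exp ((2 • traceDual d - quadDual ξ) y) - 1)
          (jumpMeasure γ ν g h) ∧
        ∫ y, (Real.exp ((2 • traceDual d - quadDual ξ) y) - 1) ∂(jumpMeasure γ ν g h) ≤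
          A - if ‖ξ‖ < R * (h⁻¹) ^ (k + 2) then 0 else c * ‖ξ‖ ^ (α / (k + 2)) := by
  obtain ⟨k, R, c, hR, hc, hlow⟩ := exists_laplace_lower_bound hg hγ hH hν
  obtain ⟨A, hA⟩ := exp_sub_one_jumpMeasure hg hγ hν (2 • traceDual d)
  refine ⟨k, R, c, A, hR, hc, fun h hh hh1 ξ => ?_⟩
  obtain ⟨hi2, hA2⟩ := hA h hh hh1
  obtain ⟨_, hB⟩ := exp_sub_one_jumpMeasure hg hγ hν (2 • traceDual d - quadDual ξ)
  obtain ⟨_, hB'⟩ := exp_sub_one_jumpMeasure hg hγ hν (-quadDual ξ)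
  have hi := (hB h hh hh1).1
  have hiq : Integrable (fun y => 1 - Real.exp (-quadDual ξ y)) (jumpMeasure γ ν g h) :=
    (hB' h hh hh1).1.neg.congr (ae_of_all _ fun y => by simp)
  have hcone := ae_mem_positiveCone_jumpMeasure hγ hν g h
  have hle : ∫ y, (Real.exp ((2 • traceDual d - quadDual ξ) y) - 1) ∂(jumpMeasure γ ν g h) ≤
      A - ∫ y, (1 - Real.exp (-quadDual ξ y)) ∂(jumpMeasure γ ν g h) := by
    refine le_trans ?_ (sub_le_sub_right hA2 _)
    rw [← integral_sub hi2 hiq]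
    refine integral_mono_ae hi (hi2.sub hiq) ?_
    filter_upwards [hcone] with y hy
    obtain ⟨h0, h1⟩ := hy ξ
    have hQ : 0 ≤ quadDual ξ y := h0
    have hT : 0 ≤ (2 • traceDual d) y := by
      by_contra! hneg
      have e : (2 • traceDual d) y = 2 * traceForm d y.2 := by simp [traceDual]
      have hnn : 0 ≤ traceForm d y.2 := by
        rw [traceForm, sum_apply]
        exact Finset.sum_nonneg fun i _ => (hy _).1
      rw [e] at hneg
      linarith
    have e3 : Real.exp ((2 • traceDual d - quadDual ξ) y) =
        Real.exp ((2 • traceDual d) y) * Real.exp (-quadDual ξ y) := by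
      rw [← Real.exp_add, ← sub_eq_add_neg, sub_apply]
    rw [e3]
    have e1 := Real.one_le_exp hT
    have e2 := Real.exp_le_one_iff.2 (neg_nonpos.2 hQ)
    nlinarith
  refine ⟨hi, hle.trans (sub_le_sub_left ?_ _)⟩
  split_ifs with hξ
  · refine integral_nonneg_of_ae ?_
    filter_upwards [hcone] with y hy
    have := (hy ξ).1
    simp only [Pi.zero_apply, sub_nonneg, Real.exp_le_one_iff, neg_nonpos]
    exact this
  · exact hlow h hh hh1 ξ (not_lt.1 hξ)

lemma rpow_mul_exp_neg_le {β a s : ℝ} (hβ : 0 < β) (ha : 0 < a) (d : ℕ) :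
    ∃ K : ℝ, 0 ≤ K ∧ ∀ r : ℝ, 1 ≤ r →
      r ^ s * Real.exp (-(a * r ^ β)) ≤ K * (1 + r) ^ (-((d : ℝ) + 1)) := by
  -- `e^x` is bounded below by `x ^ j / j!`, with `j` so large that `β j ≥ s + d + 1`
  set j := ⌈(s + d + 1) / β⌉₊ with hj
  have hjβ : s + d + 1 ≤ β * j := by
    have := Nat.le_ceil ((s + d + 1) / β)
    rwa [div_le_iff₀ hβ, mul_comm] at this
  refine ⟨j.factorial / a ^ j * 2 ^ ((d : ℝ) + 1), by positivity, fun r hr => ?_⟩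
  have hr0 : 0 < r := by linarith
  have hexp : Real.exp (-(a * r ^ β)) ≤ j.factorial / a ^ j * r ^ (-(β * j)) := by
    have h1 := Real.pow_div_factorial_le_exp (x := a * r ^ β) (by positivity) j
    rw [Real.exp_neg, inv_le_comm₀ (Real.exp_pos _) (by positivity)]
    refine le_trans (le_of_eq ?_) h1
    rw [Real.rpow_neg hr0.le, Real.rpow_mul hr0.le, Real.rpow_natCast, mul_pow]
    field_simp
  calc r ^ s * Real.exp (-(a * r ^ β))
      ≤ r ^ s * (j.factorial / a ^ j * r ^ (-(β * j))) := by gcongr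
    _ = j.factorial / a ^ j * r ^ (s - β * j) := by
        rw [sub_eq_add_neg, Real.rpow_add hr0]; ring
    _ ≤ j.factorial / a ^ j * r ^ (-((d : ℝ) + 1)) := by
        gcongr
        linarith
    _ ≤ j.factorial / a ^ j * (2 ^ ((d : ℝ) + 1) * (1 + r) ^ (-((d : ℝ) + 1))) := by
        gcongr
        rw [Real.rpow_neg hr0.le, Real.rpow_neg (by positivity), ← div_eq_mul_inv,
          ← Real.div_rpow (by norm_num) (by positivity), ← Real.inv_rpow hr0.le]
        refine Real.rpow_le_rpow (by positivity) ?_ (by positivity)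
        rw [inv_eq_one_div, div_le_div_iff₀ hr0 (by positivity)]
        linarith
    _ = _ := by ring

/-- A weight of polynomial growth, cut off by a stretched exponential outside the ball of radius
`ρ`, has an integral of the order of the contribution of this ball. -/
lemma lintegral_cutoff_le (d : ℕ) {s β a : ℝ} (hs : 0 ≤ s) (hβ : 0 < β) (ha : 0 < a) :
    ∃ J : ℝ, 0 ≤ J ∧ ∀ ρ : ℝ, 1 ≤ ρ →
      ∫⁻ ξ : EuclideanSpace ℝ (Fin d), ENNReal.ofReal
        (‖ξ‖ ^ s * Real.exp (-if ‖ξ‖ < ρ then 0 else a * ‖ξ‖ ^ β)) ≤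
          ENNReal.ofReal (J * ρ ^ (s + d)) := by
  obtain ⟨K, hK0, hK⟩ := rpow_mul_exp_neg_le (s := s) hβ ha d
  set μ := (volume : Measure (EuclideanSpace ℝ (Fin d))) with hμ
  have hfin := finite_integral_one_add_norm (E := EuclideanSpace ℝ (Fin d)) (μ := μ)
    (r := (d : ℝ) + 1) (by simp)
  set I := ∫⁻ ξ : EuclideanSpace ℝ (Fin d), ENNReal.ofReal ((1 + ‖ξ‖) ^ (-((d : ℝ) + 1))) ∂μ
  obtain ⟨i, hi0, hIr⟩ : ∃ i : ℝ, 0 ≤ i ∧ I = ENNReal.ofReal i :=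
    ⟨I.toReal, ENNReal.toReal_nonneg, (ENNReal.ofReal_toReal hfin.ne).symm⟩
  set v := μ.real (Metric.ball 0 1) with hv
  refine ⟨v + K * i, by positivity, fun ρ hρ => ?_⟩
  have hρ0 : 0 < ρ := by linarith
  have hpt : ∀ ξ : EuclideanSpace ℝ (Fin d), ENNReal.ofReal
      (‖ξ‖ ^ s * Real.exp (-if ‖ξ‖ < ρ then 0 else a * ‖ξ‖ ^ β)) ≤
        (Metric.ball 0 ρ).indicator (fun _ => ENNReal.ofReal (ρ ^ s)) ξ +
          ENNReal.ofReal K * ENNReal.ofReal ((1 + ‖ξ‖) ^ (-((d : ℝ) + 1))) := by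
    intro ξ
    split_ifs with h
    · rw [Set.indicator_of_mem (by simpa using h), neg_zero, Real.exp_zero, mul_one]
      refine le_add_right (ENNReal.ofReal_le_ofReal ?_)
      gcongr
    · rw [← ENNReal.ofReal_mul hK0]
      exact le_add_left (ENNReal.ofReal_le_ofReal (hK _ (hρ.trans (not_lt.1 h))))
  refine (lintegral_mono hpt).trans ?_
  rw [lintegral_add_right _ (by fun_prop), lintegral_indicator_const measurableSet_ball,
    lintegral_const_mul' _ _ ENNReal.ofReal_ne_top, Measure.addHaar_ball_of_pos _ _ hρ0,
    finrank_euclideanSpace_fin]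
  change _ + ENNReal.ofReal K * I ≤ _
  rw [hIr,
    ← ENNReal.ofReal_toReal (measure_ball_lt_top (μ := volume)
      (x := (0 : EuclideanSpace ℝ (Fin d))) (r := 1)).ne, ← ENNReal.ofReal_mul (by positivity),
    ← ENNReal.ofReal_mul (by positivity), ← ENNReal.ofReal_mul hK0,
    ← ENNReal.ofReal_add (by positivity) (by positivity)]
  refine ENNReal.ofReal_le_ofReal ?_
  change ρ ^ s * (ρ ^ d * v) + K * i ≤ _
  have h1 : 1 ≤ ρ ^ (s + d) := Real.one_le_rpow hρ (by positivity)
  have h2 : ρ ^ s * (ρ ^ d * v) = v * ρ ^ (s + d) := by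
    rw [Real.rpow_add hρ0, Real.rpow_natCast]; ring
  rw [h2, add_mul]
  exact add_le_add_right (le_mul_of_one_le_right (by positivity) h1) _

/-- Negative moments of the Malliavin matrix: the exponent `n` depends on `p` only (for given data),
and the constant `K` depends on `p` and `t`, but neither on `h` nor on the starting point `x`. -/
theorem proposition4 {d : ℕ} {g : ℝ → ℝ} {C α : ℝ} (hg : IsJumpDensity g C α)
    {γ : ℝ → EuclideanSpace ℝ (Fin d)} (hγ : IsJumpCurve γ) (hH : SpanCondition γ)
    {ν : ℝ → ℝ} (hν : IsJumpWeight ν) (p : ℝ) (hp : 0 < p) :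
    ∃ n : ℕ, ∀ t : ℝ≥0, 0 < t → ∃ K : ℝ, ∀ h : ℝ, 0 < h → h ≤ 1 →
      ∀ P : ℝ≥0 → Kernel (MalliavinSpace d) (MalliavinSpace d),
        IsMarkovSemigroupGeneratedBy (malliavinGenerator γ ν g h) P →
          ∀ x : EuclideanSpace ℝ (Fin d),
            ∫⁻ y, invNormPow p y.2 ∂(P t (x, 0)) ≤ ENNReal.ofReal (K * (h ^ n)⁻¹) := by
  obtain ⟨k, R, c, A, hR, hc, hexp⟩ := exists_exponent_bound hg hγ hH hν
  set q : ℝ := (k + 2) * (2 * p + d) with hq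
  have hq0 : 0 ≤ q := by positivity
  refine ⟨⌈q⌉₊, fun t ht => ?_⟩
  have ht' : (0 : ℝ) < t := ht
  have hα := hg.index_pos
  obtain ⟨J, hJ0, hJ⟩ := lintegral_cutoff_le d (s := 2 * p) (β := α / (k + 2)) (a := t * c)
    (by positivity) (by positivity) (by positivity)
  -- the constant of `invNormPow_le`
  set κ := 4 ^ p * Real.exp 2 /
    (volume : Measure (EuclideanSpace ℝ (Fin d))).real (Metric.ball 0 1) with hκ
  have hκ0 : 0 ≤ κ := by positivity
  refine ⟨4 ^ p + κ * (Real.exp (t * A) * (J * R ^ (2 * p + d))), fun h hh hh1 P hP x => ?_⟩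
  have hh1' : 1 ≤ h⁻¹ := (one_le_inv₀ hh).2 hh1
  have hρ := lintegral_norm_jumpMeasure hg hγ hν hh
  set ρ := jumpMeasure γ ν g h
  have hprob := LevySemigroup.law_prob ρ hρ t
  rw [hP.eq_kernel hg hγ hν hh, LevySemigroup.kernel_apply ρ hρ, Measure.dirac_conv]
  refine (lintegral_map_le _ _).trans ?_
  simp only [Prod.snd_add, zero_add]
  -- domination by exponentials of linear functionals
  set W : MalliavinSpace d → EuclideanSpace ℝ (Fin d) → ℝ≥0∞ := fun y ξ =>
    ENNReal.ofReal (‖ξ‖ ^ (2 * p) * Real.exp (2 * traceForm d y.2 - quadForm ξ y.2)) with hW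
  have hWm : Measurable (Function.uncurry W) := by
    have := (continuous_quadForm (d := d)).measurable
    simp only [hW, Function.uncurry_def]
    fun_prop
  have hbound : ∀ ξ, ∫⁻ y, W y ξ ∂(LevySemigroup.law ρ t) ≤
      ENNReal.ofReal (Real.exp (t * A)) * ENNReal.ofReal (‖ξ‖ ^ (2 * p) * Real.exp
        (-if ‖ξ‖ < R * (h⁻¹) ^ (k + 2) then 0 else t * c * ‖ξ‖ ^ (α / (k + 2)))) := by
    intro ξ
    obtain ⟨hi, hle⟩ := hexp h hh hh1 ξ
    have h1 := LevySemigroup.lintegral_exp_law_le ρ hρ t _ hi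
    have h2 : ∀ y, W y ξ = ENNReal.ofReal (‖ξ‖ ^ (2 * p)) *
        ENNReal.ofReal (Real.exp ((2 • traceDual d - quadDual ξ) y)) := fun y => by
      rw [← ENNReal.ofReal_mul (by positivity)]
      simp [hW, traceDual, quadDual_apply]
    simp_rw [h2]
    rw [lintegral_const_mul' _ _ ENNReal.ofReal_ne_top]
    refine (mul_le_mul_right h1 _).trans ?_
    rw [← ENNReal.ofReal_mul (by positivity), ← ENNReal.ofReal_mul (by positivity)]
    refine ENNReal.ofReal_le_ofReal ?_
    rw [mul_left_comm, ← Real.exp_add]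
    gcongr
    refine (mul_le_mul_of_nonneg_left hle ht'.le).trans (le_of_eq ?_)
    split_ifs <;> ring
  have hRh : 1 ≤ R * (h⁻¹) ^ (k + 2) := one_le_mul_of_one_le_of_one_le hR (one_le_pow₀ hh1')
  have hI : ∫⁻ y, (∫⁻ ξ, W y ξ) ∂(LevySemigroup.law ρ t) ≤
      ENNReal.ofReal (Real.exp (t * A) * (J * (R * (h⁻¹) ^ (k + 2)) ^ (2 * p + d))) := by
    rw [lintegral_lintegral_swap hWm.aemeasurable]
    refine (lintegral_mono hbound).trans ?_
    rw [lintegral_const_mul' _ _ ENNReal.ofReal_ne_top, ENNReal.ofReal_mul (Real.exp_nonneg _)]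
    gcongr
    exact hJ _ hRh
  have hcone : ∀ᵐ y ∂(LevySemigroup.law ρ t), y ∈ positiveCone d :=
    LevySemigroup.ae_mem_law hρ t (isClosed_positiveCone d)
      (ae_mem_positiveCone_jumpMeasure hγ hν g h)
  calc ∫⁻ y, invNormPow p y.2 ∂(LevySemigroup.law ρ t)
      ≤ ∫⁻ y, (ENNReal.ofReal (4 ^ p) + ENNReal.ofReal κ * ∫⁻ ξ, W y ξ)
          ∂(LevySemigroup.law ρ t) := by
        refine lintegral_mono_ae ?_
        filter_upwards [hcone] with y hy
        exact invNormPow_le hp hy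
    _ = ENNReal.ofReal (4 ^ p) + ENNReal.ofReal κ *
          ∫⁻ y, (∫⁻ ξ, W y ξ) ∂(LevySemigroup.law ρ t) := by
        rw [lintegral_add_left measurable_const, lintegral_const_mul' _ _ ENNReal.ofReal_ne_top]
        simp
    _ ≤ ENNReal.ofReal (4 ^ p) + ENNReal.ofReal κ *
          ENNReal.ofReal (Real.exp (t * A) * (J * (R * (h⁻¹) ^ (k + 2)) ^ (2 * p + d))) := by
        gcongr
    _ = ENNReal.ofReal (4 ^ p +
          κ * (Real.exp (t * A) * (J * (R * (h⁻¹) ^ (k + 2)) ^ (2 * p + d)))) := by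
        rw [← ENNReal.ofReal_mul hκ0, ← ENNReal.ofReal_add (by positivity) (by positivity)]
    _ ≤ _ := by
        refine ENNReal.ofReal_le_ofReal ?_
        have hpow : (R * (h⁻¹) ^ (k + 2)) ^ (2 * p + d) ≤
            R ^ (2 * p + d) * (h ^ ⌈q⌉₊)⁻¹ := by
          rw [Real.mul_rpow (by positivity) (by positivity), ← Real.rpow_natCast h⁻¹ (k + 2),
            ← Real.rpow_mul (by positivity), ← inv_pow, ← Real.rpow_natCast h⁻¹ ⌈q⌉₊]
          gcongr
          push_cast
          exact Nat.le_ceil q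
        have hone : 1 ≤ (h ^ ⌈q⌉₊)⁻¹ := by
          rw [← inv_pow]; exact one_le_pow₀ hh1'
        calc _ ≤ 4 ^ p * (h ^ ⌈q⌉₊)⁻¹ +
              κ * (Real.exp (t * A) * (J * (R ^ (2 * p + d) * (h ^ ⌈q⌉₊)⁻¹))) := by
              gcongr
              exact le_mul_of_one_le_right (by positivity) hone
          _ = _ := by ring
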